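/- **Setting.** All manifolds and maps are smooth, and $T=(S^1)^2$, $S^1=\{\lambda\in\mathbb C: |\lambda|=1\}$. A moment map for an action of $T$ on a symplectic manifold $(N,\omega)$ is a map $\Phi=(\Phi_1,\Phi_2)\colon N\to\mathbb R^2$ with $d\Phi_j=-\iota(\xi_j)\omega$, where $\xi_j$ is the velocity field of $t\mapsto e^{it}$ acting through the $j$-th circle. A *corner manifold* is a connected symplectic $4$-manifold with an effective action of $T$ and a proper moment map $\Phi$ whose image lies in $(\mathbb R_{\ge0})^2$ and contains all points of $(\mathbb R_{\ge 0})^2$ with sufficiently large coordinate sum. Let $n\ge2$ and let $$\Delta=\bigcap_{i=1}^n\{w\in\mathbb R^2:\langle w,v_i\rangle\ge a_i\},\qquad v_i=(\alpha_i,\beta_i)\in\mathbb Z^2,\ a_i\in\mathbb R,$$ where $v_1=(1,0)$, $v_n=(0,1)$, $a_1=a_n=0$, the $v_i$ are ordered counter-clockwise (so $\det(v_i,v_j)>0$ for $i<j$), each set $\{w\in\Delta:\langle w,v_i\rangle=a_i\}$ is a non-trivial edge (it has more than one point), and $v_i,v_{i+1}$ form a basis of $\mathbb Z^2$ for $1\le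 i<n$. Let $$M_\Delta=\Big\{x\in\mathbb C^n:\tfrac12(\alpha_i|x_1|^2-|x_i|^2+\beta_i|x_n|^2)=a_i\ \text{ for } 1<i<n\Big\}\Big/K,$$ $$K=\Big\{k\in(S^1)^n:\textstyle\prod_i k_i^{\alpha_i}=\prod_i k_i^{\beta_i}=1\Big\},$$ with the symplectic form induced by $\frac i2\sum_j dx_j\wedge d\bar x_j$, the action $(\lambda_1,\lambda_2)\cdot[x]=[\lambda_1x_1,x_2,\dots,x_{n-1},\lambda_2x_n]$ and the moment map $[x]\mapsto\frac12(|x_1|^2,|x_n|^2)$. Let $N$ be a corner manifold with moment image $\Delta$, identified with $M_\Delta$ by a $T$-equivariant symplectomorphism that intertwines the moment maps. For $1<i<n$ let $S_i=\{p\in N:\langle\Phi(p),v_i\rangle=a_i\}$, let $D=\bigcup_{1<i<n}S_i$ be the chain of isotropy spheres, and let $$\psi\colon N\smallsetminus D\to\mathbb C^2,\qquad \psi([x])=\Big(x_1\prod_{1<j<n}\big(x_j/|x_j|\big)^{\alpha_j},\ x_n\prod_{1<j<n}\big(x_j/|x_j|\big)^{\beta_j}\Big)$$ be the symplectic blowup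 map. Let $N'$ be a mirror of $N$: a corner manifold with moment map $\Phi'$ and moment image $\Delta'$, the reflection of $\Delta$ across the diagonal, which is given by $v'_i=(\beta_{n+1-i},\alpha_{n+1-i})$ and $a'_i=a_{n+1-i}$, identified in the same way with $M_{\Delta'}$; let $S'_i$, $D'$, $\psi'$ be the corresponding objects. For $\varepsilon>0$ let $U_\varepsilon$ be the preimage under $\Phi$ of $\{w: w_1\ge0,\ w_2\ge0,\ w_1+w_2<\varepsilon\}$; it is called a triangular neighborhood if it contains $D$. **Lemma.** Let $\beta>0$ be such that $U_\beta$ is a triangular neighborhood of $D$. There is a diffeomorphism $H\colon N\to N'$, preserving the orientations defined by the symplectic forms, such that - $(\psi'\circ H\circ\psi^{-1})(z)=z$ for all $z\in\psi(N\smallsetminus U_\beta)$; that is, for every $p\in N\smallsetminus U_\beta$ one has $H(p)\notin D'$ and $\psi'(H(p))=\psi(p)$; - $H$ intertwines the moment maps for the diagonal circle actions: $(\Phi'_1+\Phi'_2)\circ H=\Phi_1+\Phi_2$; - $H$ is equivariant for the anti-diagonal circle actions: $H((\lambda,\lambda^{-1})\cdot p)=(\lambda,\lambda^{-1})\cdot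 H(p)$ for all $\lambda\in S^1$, $p\in N$; - $H(S_i)=S'_{n+1-i}$ for all $1<i<n$. -/

import Mathlib

open scoped Manifold ContDiff Topology

noncomputable section

/-! ### Symplectic `4`-manifolds with Hamiltonian torus action

Smooth `4`-manifolds are modelled on `ℂ × ℂ`, regarded as a real vector space. A differential
`2`-form on `N` is a field of bilinear forms on the tangent spaces. -/

/-- A field of bilinear forms on the tangent spaces of `N`. -/
abbrev BilinField (N : Type*) [TopologicalSpace N] [ChartedSpace (ℂ × ℂ) N] :=
  ∀ p : N, TangentSpace 𝓘(ℝ, ℂ × ℂ) p →L[ℝ] TangentSpace 𝓘(ℝ, ℂ × ℂ) p →L[ℝ] ℝ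

section Symplectic

variable {N : Type*} [TopologicalSpace N] [ChartedSpace (ℂ × ℂ) N]

/-- The local representation of `Ω` in the preferred chart at `p`: the pull-back of `Ω` under the
inverse of that chart. -/
def BilinField.inChart (Ω : BilinField N) (p : N) (y : ℂ × ℂ) : (ℂ × ℂ) →L[ℝ] (ℂ × ℂ) →L[ℝ] ℝ :=
  let e := (extChartAt 𝓘(ℝ, ℂ × ℂ) p).symm
  let d : (ℂ × ℂ) →L[ℝ] (ℂ × ℂ) := mfderiv 𝓘(ℝ, ℂ × ℂ) 𝓘(ℝ, ℂ × ℂ) e y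
  let b : (ℂ × ℂ) →L[ℝ] (ℂ × ℂ) →L[ℝ] ℝ := Ω (e y)
  b.bilinearComp d d

/-- A symplectic form: a smooth, closed, non-degenerate `2`-form. Closedness `dΩ = 0` is written
out in the charts. -/
structure IsSymplecticForm (Ω : BilinField N) : Prop where
  alternating : ∀ (p : N) (u : TangentSpace 𝓘(ℝ, ℂ × ℂ) p), Ω p u u = 0
  nondegenerate : ∀ (p : N) (u : TangentSpace 𝓘(ℝ, ℂ × ℂ) p), (∀ v, Ω p u v = 0) → u = 0
  smooth : ∀ p : N, ContDiffOn ℝ ∞ (Ω.inChart p) (extChartAt 𝓘(ℝ, ℂ × ℂ) p).target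
  closed : ∀ p : N, ∀ y ∈ (extChartAt 𝓘(ℝ, ℂ × ℂ) p).target, ∀ u v w : ℂ × ℂ,
    fderiv ℝ (Ω.inChart p) y u v w + fderiv ℝ (Ω.inChart p) y v w u
      + fderiv ℝ (Ω.inChart p) y w u v = 0

/-- Half of the top exterior power `Ω ∧ Ω`, the volume form that orients a symplectic
`4`-manifold. -/
def BilinField.liouville (Ω : BilinField N) (p : N)
    (u₁ u₂ u₃ u₄ : TangentSpace 𝓘(ℝ, ℂ × ℂ) p) : ℝ :=
  Ω p u₁ u₂ * Ω p u₃ u₄ - Ω p u₁ u₃ * Ω p u₂ u₄ + Ω p u₁ u₄ * Ω p u₂ u₃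

/-- `f : N → N'` preserves the orientations defined by the symplectic forms: its differential takes
positively oriented frames to positively oriented frames. -/
def PreservesOrientation {N' : Type*} [TopologicalSpace N'] [ChartedSpace (ℂ × ℂ) N']
    (Ω : BilinField N) (Ω' : BilinField N') (f : N → N') : Prop :=
  ∀ (p : N) (u₁ u₂ u₃ u₄ : TangentSpace 𝓘(ℝ, ℂ × ℂ) p), 0 < Ω.liouville p u₁ u₂ u₃ u₄ →
    0 < Ω'.liouville (f p)
      (mfderiv 𝓘(ℝ, ℂ × ℂ) 𝓘(ℝ, ℂ × ℂ) f p u₁) (mfderiv 𝓘(ℝ, ℂ × ℂ) 𝓘(ℝ, ℂ × ℂ) f p u₂)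
      (mfderiv 𝓘(ℝ, ℂ × ℂ) 𝓘(ℝ, ℂ × ℂ) f p u₃) (mfderiv 𝓘(ℝ, ℂ × ℂ) 𝓘(ℝ, ℂ × ℂ) f p u₄)

/-- The vector field generating the action of the first circle factor: the velocity at `t = 0` of
`t ↦ (e^{it}, 1) • p`. -/
def gen₁ [MulAction (Circle × Circle) N] (p : N) : TangentSpace 𝓘(ℝ, ℂ × ℂ) p :=
  (mfderiv 𝓘(ℝ, ℝ) 𝓘(ℝ, ℂ × ℂ) (fun t : ℝ => ((Circle.exp t, 1) : Circle × Circle) • p) 0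
    (1 : ℝ) : ℂ × ℂ)

/-- The vector field generating the action of the second circle factor: the velocity at `t = 0` of
`t ↦ (1, e^{it}) • p`. -/
def gen₂ [MulAction (Circle × Circle) N] (p : N) : TangentSpace 𝓘(ℝ, ℂ × ℂ) p :=
  (mfderiv 𝓘(ℝ, ℝ) 𝓘(ℝ, ℂ × ℂ) (fun t : ℝ => ((1, Circle.exp t) : Circle × Circle) • p) 0
    (1 : ℝ) : ℂ × ℂ)

/-- `Φ = (Φ₁, Φ₂)` is a moment map for the action of the torus on `(N, Ω)`:
`dΦⱼ = - Ω (ξⱼ, ·)`, where `ξⱼ` generates the action of the `j`-th circle. -/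
structure IsMomentMap [MulAction (Circle × Circle) N] (Ω : BilinField N) (Φ : N → ℝ × ℝ) :
    Prop where
  smooth : ContMDiff 𝓘(ℝ, ℂ × ℂ) 𝓘(ℝ, ℝ × ℝ) ∞ Φ
  deriv : ∀ (p : N) (u : TangentSpace 𝓘(ℝ, ℂ × ℂ) p),
    (mfderiv 𝓘(ℝ, ℂ × ℂ) 𝓘(ℝ, ℝ × ℝ) Φ p u : ℝ × ℝ) = (- Ω p (gen₁ p) u, - Ω p (gen₂ p) u)

/-- A corner manifold: a connected symplectic `4`-manifold with an effective Hamiltonian action of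
the `2`-torus and a proper moment map whose image lies in the positive quadrant and contains all
points of the quadrant with sufficiently large coordinate sum. -/
structure IsCornerManifold [MulAction (Circle × Circle) N] (Ω : BilinField N) (Φ : N → ℝ × ℝ) :
    Prop where
  hausdorff : T2Space N
  secondCountable : SecondCountableTopology N
  isManifold : IsManifold 𝓘(ℝ, ℂ × ℂ) ∞ N
  connected : ConnectedSpace N
  symplectic : IsSymplecticForm Ω
  smooth_action : ContMDiff (((𝓡 1).prod (𝓡 1)).prod 𝓘(ℝ, ℂ × ℂ)) 𝓘(ℝ, ℂ × ℂ) ∞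
    (fun gp : (Circle × Circle) × N => gp.1 • gp.2)
  effective : FaithfulSMul (Circle × Circle) N
  momentMap : IsMomentMap Ω Φ
  proper : IsProperMap Φ
  image_subset : ∀ p, 0 ≤ (Φ p).1 ∧ 0 ≤ (Φ p).2
  subset_image : ∃ R : ℝ, ∀ w : ℝ × ℝ, 0 ≤ w.1 → 0 ≤ w.2 → R < w.1 + w.2 → w ∈ Set.range Φ

end Symplectic

/-! ### Delzant polyhedral sets -/

/-- The determinant of a pair of vectors in `ℤ²`. -/
def det₂ (u v : ℤ × ℤ) : ℤ := u.1 * v.2 - u.2 * v.1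

/-- The pairing `⟨w, v⟩`. -/
def pairing (w : ℝ × ℝ) (v : ℤ × ℤ) : ℝ := w.1 * v.1 + w.2 * v.2

/-- The data of a Delzant polyhedral set
`Δ = ⋂ i, {w | ⟨w, v i⟩ ≥ a i}` with `n = m + 2` edges (numbered `0, …, m + 1`), where the inward
normals are ordered counter-clockwise, the first is `(1, 0)` and the last is `(0, 1)` with
`a = 0` for both, each `v i` defines a non-trivial edge, and the normals to adjacent edges form a
basis of `ℤ²` (in this order, a positively oriented one; in particular all normals are
primitive). -/
structure CornerPolyhedron (m : ℕ) where
  v : Fin (m + 2) → ℤ × ℤ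
  a : Fin (m + 2) → ℝ
  v_first : v 0 = (1, 0)
  v_last : v (Fin.last (m + 1)) = (0, 1)
  a_first : a 0 = 0
  a_last : a (Fin.last (m + 1)) = 0
  counterclockwise : ∀ i j, i < j → 0 < det₂ (v i) (v j)
  delzant : ∀ k : Fin (m + 1), det₂ (v k.castSucc) (v k.succ) = 1
  nontrivial_edge : ∀ i, {w : ℝ × ℝ | (∀ j, a j ≤ pairing w (v j)) ∧
    pairing w (v i) = a i}.Nontrivial

namespace CornerPolyhedron

variable {m : ℕ} (P : CornerPolyhedron m)

/-- The polyhedral set `Δ`. -/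
def toSet : Set (ℝ × ℝ) := {w | ∀ i, P.a i ≤ pairing w (P.v i)}

/-- The reflection `Δ'` of `Δ` across the diagonal: with the numbering `1, …, n` of the edges,
`v'_i` is `v_{n+1-i}` with its coordinates exchanged, and `a'_i = a_{n+1-i}`. -/
def mirror : CornerPolyhedron m where
  v i := (P.v i.rev).swap
  a i := P.a i.rev
  v_first := by simp [P.v_last]
  v_last := by simp [P.v_first]
  a_first := by simp [P.a_last]
  a_last := by simp [P.a_first]
  counterclockwise i j hij := by
    have := P.counterclockwise j.rev i.rev (by simpa using hij)
    simp only [det₂, Prod.fst_swap, Prod.snd_swap] at *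
    linarith
  delzant k := by
    have := P.delzant k.rev
    rw [Fin.rev_castSucc, Fin.rev_succ]
    simp only [det₂, Prod.fst_swap, Prod.snd_swap] at *
    linarith
  nontrivial_edge i := by
    obtain ⟨w, hw, w', hw', hne⟩ := P.nontrivial_edge i.rev
    have key : ∀ (x : ℝ × ℝ) (u : ℤ × ℤ), pairing x.swap u.swap = pairing x u := by
      intro x u; simp only [pairing, Prod.fst_swap, Prod.snd_swap]; ring
    refine ⟨w.swap, ⟨fun j => ?_, ?_⟩, w'.swap, ⟨fun j => ?_, ?_⟩, ?_⟩
    · rw [key]; exact hw.1 _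
    · rw [key]; exact hw.2
    · rw [key]; exact hw'.1 _
    · rw [key]; exact hw'.2
    · exact fun h => hne (Prod.swap_injective h)

/-! ### The Delzant construction `M_Δ = U_Δ / K` -/

/-- The level set `U_Δ ⊆ ℂⁿ`. (For the first and the last index the equation is trivial.) -/
abbrev Level : Type := {x : Fin (m + 2) → ℂ // ∀ i,
  (1 / 2 : ℝ) * ((P.v i).1 * ‖x 0‖ ^ 2 - ‖x i‖ ^ 2 + (P.v i).2 * ‖x (Fin.last (m + 1))‖ ^ 2) = P.a i}

/-- The standard action of `(S¹)ⁿ` on the level set. -/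
instance : MulAction (Fin (m + 2) → Circle) P.Level where
  smul k x := ⟨fun i => k i * x.1 i, fun i => by simpa only [norm_mul, Circle.norm_coe, one_mul] using x.2 i⟩
  one_smul x := Subtype.ext (funext fun i => by change ((1 : Circle) : ℂ) * _ = _; simp)
  mul_smul k l x := Subtype.ext (funext fun i => by
    change ((k i * l i : Circle) : ℂ) * _ = k i * (l i * x.1 i); simp [mul_assoc])

@[simp] lemma level_smul_apply (k : Fin (m + 2) → Circle) (x : P.Level) (i : Fin (m + 2)) :
    (k • x).1 i = k i * x.1 i := rfl

/-- The subgroup `K ⊆ (S¹)ⁿ`, the kernel of the homomorphism to `(S¹)²` induced by `eᵢ ↦ v i`. -/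
def K : Subgroup (Fin (m + 2) → Circle) where
  carrier := {k | ∏ i, k i ^ (P.v i).1 = 1 ∧ ∏ i, k i ^ (P.v i).2 = 1}
  one_mem' := by simp
  mul_mem' {k l} hk hl := by
    simp only [Set.mem_ofPred_eq, Pi.mul_apply, mul_zpow, Finset.prod_mul_distrib] at *
    simp [hk.1, hk.2, hl.1, hl.2]
  inv_mem' {k} hk := by
    simp only [Set.mem_ofPred_eq, Pi.inv_apply, inv_zpow, Finset.prod_inv_distrib] at *
    simp [hk.1, hk.2]

/-- The reduced space `M_Δ = U_Δ / K`. -/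
def Model : Type := MulAction.orbitRel.Quotient P.K P.Level

instance : TopologicalSpace P.Model :=
  inferInstanceAs (TopologicalSpace (MulAction.orbitRel.Quotient P.K P.Level))

/-- The quotient map `x ↦ [x]`. -/
def quot (x : P.Level) : P.Model := Quotient.mk (MulAction.orbitRel P.K P.Level) x

/-- The standard action of `(S¹)ⁿ` commutes with that of `K`, and so descends to `M_Δ`. -/
def torusMap (k : Fin (m + 2) → Circle) : P.Model → P.Model :=
  Quotient.map (k • ·) (by
    rintro x y ⟨⟨l, hl⟩, rfl⟩
    exact ⟨⟨l, hl⟩, (smul_comm l k y : l • k • y = k • l • y)⟩)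

/-- The element `(λ₁, 1, …, 1, λ₂)` of `(S¹)ⁿ`. -/
def ends (g : Circle × Circle) (i : Fin (m + 2)) : Circle :=
  if i = 0 then g.1 else if i = Fin.last (m + 1) then g.2 else 1

/-- The residual action of `(S¹)²` on `M_Δ`:
`(λ₁, λ₂) • [x₁, …, xₙ] = [λ₁ x₁, x₂, …, xₙ₋₁, λ₂ xₙ]`. -/
instance : MulAction (Circle × Circle) P.Model where
  smul g := P.torusMap (ends g)
  one_smul p := by
    refine Quotient.inductionOn p fun x => ?_
    change P.quot (ends 1 • x) = P.quot x
    have : ends (m := m) 1 = 1 := by ext i; simp [ends]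
    rw [this, one_smul]
  mul_smul g h p := by
    refine Quotient.inductionOn p fun x => ?_
    change P.quot (ends (g * h) • x) = P.quot (ends g • ends h • x)
    have : ends (m := m) (g * h) = ends g * ends h := by
      ext i; simp only [ends, Pi.mul_apply]; split_ifs <;> simp
    rw [this, mul_smul]

/-- The moment map `[x] ↦ (|x₁|², |xₙ|²) / 2` on `M_Δ`. -/
def modelMoment : P.Model → ℝ × ℝ :=
  Quotient.lift (fun x : P.Level => ((1 / 2 : ℝ) * ‖x.1 0‖ ^ 2,
    (1 / 2 : ℝ) * ‖x.1 (Fin.last (m + 1))‖ ^ 2)) (by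
    rintro x y ⟨⟨l, hl⟩, rfl⟩
    change ((1 / 2 : ℝ) * ‖(l 0 : ℂ) * y.1 0‖ ^ 2,
      (1 / 2 : ℝ) * ‖(l (Fin.last (m + 1)) : ℂ) * y.1 (Fin.last (m + 1))‖ ^ 2) = _
    simp only [norm_mul, Circle.norm_coe, one_mul])

/-- For two indices `i`, `i'`, the map
`x ↦ (xᵢ ∏ⱼ (xⱼ / |xⱼ|) ^ det (vⱼ, v_{i'}), x_{i'} ∏ⱼ (xⱼ / |xⱼ|) ^ det (vᵢ, vⱼ))`,
where `j` runs through the indices other than `i` and `i'`. When `det (vᵢ, v_{i'}) = 1`, the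
exponents are the coordinates of `vⱼ` in the basis `vᵢ, v_{i'}`. -/
def coords (i i' : Fin (m + 2)) (x : Fin (m + 2) → ℂ) : ℂ × ℂ :=
  (x i * ∏ j ∈ ({i, i'} : Finset (Fin (m + 2)))ᶜ, (x j / ‖x j‖) ^ det₂ (P.v j) (P.v i'),
   x i' * ∏ j ∈ ({i, i'} : Finset (Fin (m + 2)))ᶜ, (x j / ‖x j‖) ^ det₂ (P.v i) (P.v j))

lemma prod_circle_of_mem_K {k : Fin (m + 2) → Circle} (hk : k ∈ P.K) (c d : ℤ) :
    ∏ j, k j ^ (c * (P.v j).1 + d * (P.v j).2) = 1 := by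
  have h1 := hk.1
  have h2 := hk.2
  simp only [zpow_add, mul_comm c, mul_comm d, zpow_mul, Finset.prod_mul_distrib,
    Finset.prod_zpow, h1, h2, one_zpow, mul_one]

lemma prod_split {M : Type*} [CommMonoid M] {i i' : Fin (m + 2)} (h : i ≠ i')
    (f : Fin (m + 2) → M) :
    ∏ j, f j = f i * f i' * ∏ j ∈ ({i, i'} : Finset (Fin (m + 2)))ᶜ, f j := by
  rw [← Finset.prod_mul_prod_compl {i, i'} f, Finset.prod_pair h]

lemma ne_of_det {i i' : Fin (m + 2)} (h : det₂ (P.v i) (P.v i') = 1) : i ≠ i' := by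
  rintro rfl; simp [det₂, mul_comm] at h

lemma coords_smul {i i' : Fin (m + 2)} (h : det₂ (P.v i) (P.v i') = 1)
    {k : Fin (m + 2) → Circle} (hk : k ∈ P.K) (x : P.Level) :
    P.coords i i' (k • x).1 = P.coords i i' x.1 := by
  have hne := P.ne_of_det h
  have e1 := P.prod_circle_of_mem_K hk (P.v i').2 (-(P.v i').1)
  have e2 := P.prod_circle_of_mem_K hk (-(P.v i).2) (P.v i).1
  have r1 : ∀ j, (P.v i').2 * (P.v j).1 + -(P.v i').1 * (P.v j).2 = det₂ (P.v j) (P.v i') := by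
    intro j; simp only [det₂]; ring
  have r2 : ∀ j, -(P.v i).2 * (P.v j).1 + (P.v i).1 * (P.v j).2 = det₂ (P.v i) (P.v j) := by
    intro j; simp only [det₂]; ring
  simp only [r1] at e1
  simp only [r2] at e2
  rw [prod_split hne] at e1 e2
  have z : ∀ w, det₂ w w = 0 := fun w => by simp [det₂, mul_comm]
  simp only [h, z, zpow_one, zpow_zero, mul_one, one_mul] at e1 e2
  have e1' := congrArg (fun c : Circle => (c : ℂ)) e1
  have e2' := congrArg (fun c : Circle => (c : ℂ)) e2
  simp only [Circle.coe_mul, Circle.coe_one] at e1' e2'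
  have pr : ∀ (s : Finset (Fin (m + 2))) (c : Fin (m + 2) → ℤ),
      ∏ j ∈ s, ((k j * x.1 j : ℂ) / ‖(k j * x.1 j : ℂ)‖) ^ c j
      = ((∏ j ∈ s, k j ^ c j : Circle) : ℂ) * ∏ j ∈ s, (x.1 j / ‖x.1 j‖) ^ c j := by
    intro s c
    have e : ((∏ j ∈ s, k j ^ c j : Circle) : ℂ) = ∏ j ∈ s, (k j : ℂ) ^ c j :=
      (map_prod Circle.coeHom _ s).trans (Finset.prod_congr rfl fun j _ => Circle.coe_zpow _ _)
    rw [e]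
    rw [← Finset.prod_mul_distrib]
    refine Finset.prod_congr rfl fun j _ => ?_
    rw [norm_mul, Circle.norm_coe, one_mul, mul_div_assoc, mul_zpow]
  simp only [coords, level_smul_apply, pr]
  refine Prod.ext ?_ ?_
  · simp only
    linear_combination (x.1 i * ∏ j ∈ ({i, i'} : Finset (Fin (m + 2)))ᶜ,
      (x.1 j / ‖x.1 j‖) ^ det₂ (P.v j) (P.v i')) * e1'
  · simp only
    linear_combination (x.1 i' * ∏ j ∈ ({i, i'} : Finset (Fin (m + 2)))ᶜ,
      (x.1 j / ‖x.1 j‖) ^ det₂ (P.v i) (P.v j)) * e2'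

/-- The map on `M_Δ` induced by `coords`. -/
def modelCoords (i i' : Fin (m + 2)) (h : det₂ (P.v i) (P.v i') = 1) : P.Model → ℂ × ℂ :=
  Quotient.lift (fun x : P.Level => P.coords i i' x.1) (by
    rintro x y ⟨⟨l, hl⟩, rfl⟩
    exact P.coords_smul h hl y)

/-- The symplectic blowup map on `M_Δ`. Since `v₁ = (1, 0)` and `vₙ = (0, 1)`, the exponents are
the coordinates of `v_j = (α_j, β_j)`:
`ψ [x] = (x₁ ∏ⱼ (xⱼ / |xⱼ|) ^ α_j, xₙ ∏ⱼ (xⱼ / |xⱼ|) ^ β_j)`, with `1 < j < n`.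
Its values where some of these `xⱼ` vanishes are irrelevant. -/
def modelBlowup : P.Model → ℂ × ℂ :=
  P.modelCoords 0 (Fin.last (m + 1)) (by simp [P.v_first, P.v_last, det₂])

/-! #### Smooth structure of `M_Δ`

For each vertex of `Δ`, where the edges `k` and `k + 1` meet, the map `coords k (k + 1)` is a chart
on the set of points `[x]` with `x_j ≠ 0` for all other `j`. -/

/-- The point `w ∈ ℝ²` with `⟨w, v_k⟩ - a_k = |z₁|² / 2` and
`⟨w, v_{k+1}⟩ - a_{k+1} = |z₂|² / 2`. -/
def vertexMoment (k : Fin (m + 1)) (z : ℂ × ℂ) : ℝ × ℝ :=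
  let s := P.a k.castSucc + (1 / 2 : ℝ) * ‖z.1‖ ^ 2
  let t := P.a k.succ + (1 / 2 : ℝ) * ‖z.2‖ ^ 2
  (s * (P.v k.succ).2 - t * (P.v k.castSucc).2, -s * (P.v k.succ).1 + t * (P.v k.castSucc).1)

lemma vertexMoment_castSucc (k : Fin (m + 1)) (z : ℂ × ℂ) :
    pairing (P.vertexMoment k z) (P.v k.castSucc) = P.a k.castSucc + (1 / 2 : ℝ) * ‖z.1‖ ^ 2 := by
  have h : ((det₂ (P.v k.castSucc) (P.v k.succ) : ℤ) : ℝ) = 1 := by rw [P.delzant k]; simp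
  simp only [det₂] at h
  push_cast at h
  simp only [pairing, vertexMoment]
  linear_combination (P.a k.castSucc + (1 / 2 : ℝ) * ‖z.1‖ ^ 2) * h

lemma vertexMoment_succ (k : Fin (m + 1)) (z : ℂ × ℂ) :
    pairing (P.vertexMoment k z) (P.v k.succ) = P.a k.succ + (1 / 2 : ℝ) * ‖z.2‖ ^ 2 := by
  have h : ((det₂ (P.v k.castSucc) (P.v k.succ) : ℤ) : ℝ) = 1 := by rw [P.delzant k]; simp
  simp only [det₂] at h
  push_cast at h
  simp only [pairing, vertexMoment]
  linear_combination (P.a k.succ + (1 / 2 : ℝ) * ‖z.2‖ ^ 2) * h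

/-- The image of the chart at the `k`-th vertex. -/
def vertexTarget (k : Fin (m + 1)) : Set (ℂ × ℂ) :=
  {z | ∀ j, j ≠ k.castSucc → j ≠ k.succ → P.a j < pairing (P.vertexMoment k z) (P.v j)}

/-- The point of `U_Δ` over `z` at which all coordinates other than the `k`-th and the `(k + 1)`-st
are positive real numbers. -/
def vertexSection (k : Fin (m + 1)) (z : ℂ × ℂ) (j : Fin (m + 2)) : ℂ :=
  if j = k.castSucc then z.1 else if j = k.succ then z.2 else
    (Real.sqrt (2 * (pairing (P.vertexMoment k z) (P.v j) - P.a j)) : ℂ)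

lemma half_norm_vertexSection {k : Fin (m + 1)} {z : ℂ × ℂ} (hz : z ∈ P.vertexTarget k)
    (j : Fin (m + 2)) : (1 / 2 : ℝ) * ‖P.vertexSection k z j‖ ^ 2
      = pairing (P.vertexMoment k z) (P.v j) - P.a j := by
  unfold vertexSection
  split_ifs with h1 h2
  · subst h1; rw [vertexMoment_castSucc]; ring
  · subst h2; rw [vertexMoment_succ]; ring
  · have := hz j h1 h2
    rw [Complex.norm_real, Real.norm_eq_abs, sq_abs, Real.sq_sqrt (by linarith)]; ring

lemma vertexSection_mem {k : Fin (m + 1)} {z : ℂ × ℂ} (hz : z ∈ P.vertexTarget k)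
    (i : Fin (m + 2)) :
    (1 / 2 : ℝ) * ((P.v i).1 * ‖P.vertexSection k z 0‖ ^ 2 - ‖P.vertexSection k z i‖ ^ 2 +
      (P.v i).2 * ‖P.vertexSection k z (Fin.last (m + 1))‖ ^ 2) = P.a i := by
  have h0 := P.half_norm_vertexSection hz 0
  have h1 := P.half_norm_vertexSection hz (Fin.last (m + 1))
  have h2 := P.half_norm_vertexSection hz i
  simp only [pairing, P.v_first, P.v_last, P.a_first, P.a_last] at h0 h1 h2
  push_cast at h0 h1
  linear_combination ((P.v i).1 : ℝ) * h0 + ((P.v i).2 : ℝ) * h1 - h2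

instance : Nonempty P.Model := by
  obtain ⟨w, ⟨hw, -⟩, -⟩ := P.nontrivial_edge 0
  have key : ∀ i, ‖((Real.sqrt (2 * (pairing w (P.v i) - P.a i)) : ℝ) : ℂ)‖ ^ 2 =
      2 * (pairing w (P.v i) - P.a i) := by
    intro i
    rw [Complex.norm_real, Real.norm_eq_abs, sq_abs, Real.sq_sqrt (by linarith [hw i])]
  refine ⟨P.quot ⟨fun i => (Real.sqrt (2 * (pairing w (P.v i) - P.a i)) : ℂ), fun i => ?_⟩⟩
  simp only [key]
  simp only [pairing, P.v_first, P.v_last, P.a_first, P.a_last]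
  push_cast
  ring

open Classical in
/-- The inverse of the chart at the `k`-th vertex, `z ↦ [vertexSection k z]`. -/
def vertexInv (k : Fin (m + 1)) (z : ℂ × ℂ) : P.Model :=
  if hz : z ∈ P.vertexTarget k then P.quot ⟨P.vertexSection k z, P.vertexSection_mem hz⟩
  else Classical.arbitrary _

lemma vertexInv_of_mem {k : Fin (m + 1)} {z : ℂ × ℂ} (hz : z ∈ P.vertexTarget k) :
    P.vertexInv k z = P.quot ⟨P.vertexSection k z, P.vertexSection_mem hz⟩ := dif_pos hz

/-- The domain of the chart at the `k`-th vertex: all `x_j`, `j ≠ k, k + 1`, are non-zero. -/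
def vertexSource (k : Fin (m + 1)) : Set P.Model :=
  P.quot '' {x | ∀ j, j ≠ k.castSucc → j ≠ k.succ → x.1 j ≠ 0}

lemma quot_eq_iff {x y : P.Level} : P.quot x = P.quot y ↔ ∃ k ∈ P.K, k • y = x := by
  constructor
  · intro h
    obtain ⟨⟨k, hk⟩, h⟩ := Quotient.exact h
    exact ⟨k, hk, h⟩
  · rintro ⟨k, hk, rfl⟩
    exact Quotient.sound ⟨⟨k, hk⟩, rfl⟩

lemma quot_mem_vertexSource {k : Fin (m + 1)} {x : P.Level} :
    P.quot x ∈ P.vertexSource k ↔ ∀ j, j ≠ k.castSucc → j ≠ k.succ → x.1 j ≠ 0 := by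
  constructor
  · rintro ⟨y, hy, h⟩ j h1 h2
    obtain ⟨l, -, rfl⟩ := P.quot_eq_iff.1 h
    have := hy j h1 h2
    rw [level_smul_apply] at this
    exact right_ne_zero_of_mul this
  · exact fun h => ⟨x, h, rfl⟩

lemma continuous_quot : Continuous P.quot := continuous_quot_mk

lemma isOpenMap_quot : IsOpenMap P.quot := by
  have : ContinuousConstSMul P.K P.Level := ⟨fun k => by
    refine Continuous.subtype_mk (continuous_pi fun i => ?_) _
    exact continuous_const.mul ((continuous_apply i).comp continuous_subtype_val)⟩
  exact isOpenMap_quotient_mk'_mul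

lemma quot_surjective : Function.Surjective P.quot := Quotient.mk_surjective

/-- The phase `c / |c|` of `c ≠ 0`. -/
def phase (c : ℂ) : Circle := Circle.exp c.arg

lemma coe_phase {c : ℂ} (hc : c ≠ 0) : (phase c : ℂ) = c / ‖c‖ := by
  have : (‖c‖ : ℂ) ≠ 0 := by simpa using hc
  rw [eq_div_iff this, phase, Circle.coe_exp, mul_comm]
  exact Complex.norm_mul_exp_arg_mul_I c

lemma coe_prod_phase {s : Finset (Fin (m + 2))} {x : Fin (m + 2) → ℂ} (hx : ∀ j ∈ s, x j ≠ 0)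
    (c : Fin (m + 2) → ℤ) :
    ∏ j ∈ s, (x j / ‖x j‖) ^ c j = ((∏ j ∈ s, phase (x j) ^ c j : Circle) : ℂ) := by
  have e : ((∏ j ∈ s, phase (x j) ^ c j : Circle) : ℂ) = ∏ j ∈ s, (phase (x j) : ℂ) ^ c j :=
    (map_prod Circle.coeHom _ s).trans (Finset.prod_congr rfl fun j _ => Circle.coe_zpow _ _)
  rw [e]
  exact Finset.prod_congr rfl fun j hj => by rw [coe_phase (hx j hj)]

lemma half_norm_level (x : P.Level) (i : Fin (m + 2)) : (1 / 2 : ℝ) * ‖x.1 i‖ ^ 2 =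
    pairing ((1 / 2 : ℝ) * ‖x.1 0‖ ^ 2, (1 / 2 : ℝ) * ‖x.1 (Fin.last (m + 1))‖ ^ 2) (P.v i)
      - P.a i := by
  have := x.2 i
  simp only [pairing]
  linear_combination -this

lemma vertexMoment_eq {k : Fin (m + 1)} {z : ℂ × ℂ} {w : ℝ × ℝ}
    (h1 : pairing w (P.v k.castSucc) = P.a k.castSucc + (1 / 2 : ℝ) * ‖z.1‖ ^ 2)
    (h2 : pairing w (P.v k.succ) = P.a k.succ + (1 / 2 : ℝ) * ‖z.2‖ ^ 2) :
    P.vertexMoment k z = w := by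
  have h : ((det₂ (P.v k.castSucc) (P.v k.succ) : ℤ) : ℝ) = 1 := by rw [P.delzant k]; simp
  simp only [det₂] at h
  push_cast at h
  simp only [vertexMoment, ← h1, ← h2, pairing]
  refine Prod.ext ?_ ?_
  · simp only; linear_combination w.1 * h
  · simp only; linear_combination w.2 * h

lemma mem_compl_pair {i i' j : Fin (m + 2)} :
    j ∈ ({i, i'} : Finset (Fin (m + 2)))ᶜ ↔ j ≠ i ∧ j ≠ i' := by simp

lemma coords_eq {k : Fin (m + 1)} {x : Fin (m + 2) → ℂ}
    (hx : ∀ j, j ≠ k.castSucc → j ≠ k.succ → x j ≠ 0) :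
    P.coords k.castSucc k.succ x =
      (x k.castSucc * (∏ j ∈ ({k.castSucc, k.succ} : Finset (Fin (m + 2)))ᶜ,
        phase (x j) ^ det₂ (P.v j) (P.v k.succ) : Circle),
       x k.succ * (∏ j ∈ ({k.castSucc, k.succ} : Finset (Fin (m + 2)))ᶜ,
        phase (x j) ^ det₂ (P.v k.castSucc) (P.v j) : Circle)) := by
  have hx' : ∀ j ∈ ({k.castSucc, k.succ} : Finset (Fin (m + 2)))ᶜ, x j ≠ 0 :=
    fun j hj => hx j (mem_compl_pair.1 hj).1 (mem_compl_pair.1 hj).2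
  rw [coords, coe_prod_phase hx', coe_prod_phase hx']

lemma vertexMoment_coords {k : Fin (m + 1)} {x : P.Level}
    (hx : ∀ j, j ≠ k.castSucc → j ≠ k.succ → x.1 j ≠ 0) :
    P.vertexMoment k (P.coords k.castSucc k.succ x.1) =
      ((1 / 2 : ℝ) * ‖x.1 0‖ ^ 2, (1 / 2 : ℝ) * ‖x.1 (Fin.last (m + 1))‖ ^ 2) := by
  apply P.vertexMoment_eq
  · rw [P.coords_eq hx]
    simp only [norm_mul, Circle.norm_coe, mul_one]
    linarith [P.half_norm_level x k.castSucc]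
  · rw [P.coords_eq hx]
    simp only [norm_mul, Circle.norm_coe, mul_one]
    linarith [P.half_norm_level x k.succ]

lemma coords_mem {k : Fin (m + 1)} {x : P.Level}
    (hx : ∀ j, j ≠ k.castSucc → j ≠ k.succ → x.1 j ≠ 0) :
    P.coords k.castSucc k.succ x.1 ∈ P.vertexTarget k := by
  intro j h1 h2
  rw [P.vertexMoment_coords hx]
  have := P.half_norm_level x j
  have : 0 < ‖x.1 j‖ := norm_pos_iff.2 (hx j h1 h2)
  have : 0 < (1 / 2 : ℝ) * ‖x.1 j‖ ^ 2 := by positivity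
  linarith

lemma vertexSection_ne_zero {k : Fin (m + 1)} {z : ℂ × ℂ} (hz : z ∈ P.vertexTarget k)
    (j : Fin (m + 2)) (h1 : j ≠ k.castSucc) (h2 : j ≠ k.succ) : P.vertexSection k z j ≠ 0 := by
  have := hz j h1 h2
  intro h0
  have := P.half_norm_vertexSection hz j
  rw [h0] at this
  simp at this
  linarith

lemma coords_vertexSection {k : Fin (m + 1)} {z : ℂ × ℂ} (hz : z ∈ P.vertexTarget k) :
    P.coords k.castSucc k.succ (P.vertexSection k z) = z := by
  have ph : ∀ j ∈ ({k.castSucc, k.succ} : Finset (Fin (m + 2)))ᶜ,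
      P.vertexSection k z j / ‖P.vertexSection k z j‖ = 1 := by
    intro j hj
    obtain ⟨h1, h2⟩ := mem_compl_pair.1 hj
    have hne := P.vertexSection_ne_zero hz j h1 h2
    simp only [vertexSection, if_neg h1, if_neg h2] at hne ⊢
    rw [Complex.norm_real, Real.norm_eq_abs, abs_of_nonneg (Real.sqrt_nonneg _), div_self hne]
  have pr : ∀ c : Fin (m + 2) → ℤ, ∏ j ∈ ({k.castSucc, k.succ} : Finset (Fin (m + 2)))ᶜ,
      (P.vertexSection k z j / ‖P.vertexSection k z j‖) ^ c j = 1 := fun c =>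
    Finset.prod_eq_one fun j hj => by rw [ph j hj, one_zpow]
  rw [coords, pr, pr]
  simp [vertexSection, k.castSucc_lt_succ.ne']

lemma vertexSection_coords {k : Fin (m + 1)} {x : P.Level}
    (hx : ∀ j, j ≠ k.castSucc → j ≠ k.succ → x.1 j ≠ 0) :
    P.quot ⟨_, P.vertexSection_mem (P.coords_mem hx)⟩ = P.quot x := by
  set s := ({k.castSucc, k.succ} : Finset (Fin (m + 2)))ᶜ
  set A : Circle := ∏ j ∈ s, phase (x.1 j) ^ det₂ (P.v j) (P.v k.succ) with hA
  set B : Circle := ∏ j ∈ s, phase (x.1 j) ^ det₂ (P.v k.castSucc) (P.v j) with hB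
  have hne := k.castSucc_lt_succ.ne
  have hdet := P.delzant k
  rw [quot_eq_iff]
  let l : Fin (m + 2) → Circle := fun j =>
    if j = k.castSucc then A else if j = k.succ then B else (phase (x.1 j))⁻¹
  have l1 : l k.castSucc = A := if_pos rfl
  have l2 : l k.succ = B := by simp [l, hne.symm]
  have l3 : ∀ j ∈ s, l j = (phase (x.1 j))⁻¹ := fun j hj => by
    simp [l, (mem_compl_pair.1 hj).1, (mem_compl_pair.1 hj).2]
  have prod : ∀ f : Fin (m + 2) → ℤ,
      (∀ j, f j = det₂ (P.v j) (P.v k.succ) * f k.castSucc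
        + det₂ (P.v k.castSucc) (P.v j) * f k.succ) → ∏ j, l j ^ f j = 1 := by
    intro f hf
    rw [prod_split hne, l1, l2, hA, hB, ← Finset.prod_zpow, ← Finset.prod_zpow,
      ← Finset.prod_mul_distrib, ← Finset.prod_mul_distrib]
    refine Finset.prod_eq_one fun j hj => ?_
    rw [l3 j hj, ← zpow_mul, ← zpow_mul, ← zpow_add, ← hf j, inv_zpow, mul_inv_cancel]
  refine ⟨l, ⟨prod _ fun j => ?_, prod _ fun j => ?_⟩, ?_⟩
  · simp only [det₂] at hdet ⊢
    linear_combination -(P.v j).1 * hdet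
  · simp only [det₂] at hdet ⊢
    linear_combination -(P.v j).2 * hdet
  · refine Subtype.ext (funext fun j => ?_)
    rw [level_smul_apply]
    change (l j : ℂ) * x.1 j = P.vertexSection k (P.coords k.castSucc k.succ x.1) j
    by_cases h1 : j = k.castSucc
    · subst h1
      rw [l1, P.coords_eq hx]
      simp only [vertexSection, if_true]
      rw [mul_comm]
    by_cases h2 : j = k.succ
    · subst h2
      rw [l2, P.coords_eq hx]
      simp only [vertexSection, if_true, if_neg hne.symm]
      rw [mul_comm]
    · rw [l3 j (mem_compl_pair.2 ⟨h1, h2⟩)]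
      simp only [vertexSection, if_neg h1, if_neg h2, P.vertexMoment_coords hx,
        ← P.half_norm_level x j]
      have hx0 := hx j h1 h2
      have hn : (‖x.1 j‖ : ℂ) ≠ 0 := by simpa using hx0
      rw [show 2 * ((1 / 2 : ℝ) * ‖x.1 j‖ ^ 2) = ‖x.1 j‖ ^ 2 by ring,
        Real.sqrt_sq (norm_nonneg _), Circle.coe_inv, coe_phase hx0]
      field_simp

/-- Where the coordinates with the indices `≠ i, i'` do not vanish. -/
def nonvanishing (i i' : Fin (m + 2)) : Set (Fin (m + 2) → ℂ) :=
  {x | ∀ j, j ≠ i → j ≠ i' → x j ≠ 0}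

lemma contDiffOn_coords (i i' : Fin (m + 2)) :
    ContDiffOn ℝ ∞ (P.coords i i') (nonvanishing i i') := by
  intro x hx
  refine ContDiffAt.contDiffWithinAt ?_
  have ap : ∀ j, ContDiffAt ℝ ∞ (fun y : Fin (m + 2) → ℂ => y j) x := fun j =>
    (contDiff_apply ℝ ℂ j).contDiffAt
  have ph : ∀ (c : ℤ), ∀ j ∈ ({i, i'} : Finset (Fin (m + 2)))ᶜ,
      ContDiffAt ℝ ∞ (fun y : Fin (m + 2) → ℂ => (y j / ‖y j‖) ^ c) x := by
    intro c j hj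
    have hx0 : x j ≠ 0 := hx j (mem_compl_pair.1 hj).1 (mem_compl_pair.1 hj).2
    have hn : (‖x j‖ : ℂ) ≠ 0 := by simpa using hx0
    have z : ContDiffAt ℝ ∞ (fun y : ℂ => y ^ c) (x j / ‖x j‖) :=
      ((analyticAt_id.zpow (n := c) (div_ne_zero hx0 hn)).contDiffAt (𝕜 := ℂ)).restrict_scalars ℝ
    have n1 : ContDiffAt ℝ ∞ (fun y : Fin (m + 2) → ℂ => ‖y j‖⁻¹) x :=
      ((ap j).norm ℝ hx0).inv (norm_ne_zero_iff.2 hx0)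
    have n2 : ContDiffAt ℝ ∞ (fun y : Fin (m + 2) → ℂ => y j / ‖y j‖) x := by
      refine (n1.smul (ap j)).congr_of_eventuallyEq (Filter.Eventually.of_forall fun y => ?_)
      simp [div_eq_inv_mul]
    exact z.comp x n2
  exact ((ap i).mul (contDiffAt_prod fun j hj => ph _ j hj)).prodMk
    ((ap i').mul (contDiffAt_prod fun j hj => ph _ j hj))

lemma contDiff_vertexMoment (k : Fin (m + 1)) (u : ℤ × ℤ) :
    ContDiff ℝ ∞ (fun z => pairing (P.vertexMoment k z) u) := by
  have h1 : ContDiff ℝ ∞ (fun z : ℂ × ℂ => ‖z.1‖ ^ 2) := contDiff_fst.norm_sq ℝ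
  have h2 : ContDiff ℝ ∞ (fun z : ℂ × ℂ => ‖z.2‖ ^ 2) := contDiff_snd.norm_sq ℝ
  simp only [pairing, vertexMoment]
  fun_prop

lemma isOpen_vertexTarget (k : Fin (m + 1)) : IsOpen (P.vertexTarget k) := by
  have : P.vertexTarget k = ⋂ j, ⋂ (_ : j ≠ k.castSucc), ⋂ (_ : j ≠ k.succ),
      {z | P.a j < pairing (P.vertexMoment k z) (P.v j)} := by
    ext z; simp [vertexTarget]
  rw [this]
  refine isOpen_iInter_of_finite fun j => isOpen_iInter_of_finite fun _ =>
    isOpen_iInter_of_finite fun _ => ?_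
  exact isOpen_lt continuous_const (P.contDiff_vertexMoment k (P.v j)).continuous

lemma contDiffOn_vertexSection (k : Fin (m + 1)) :
    ContDiffOn ℝ ∞ (P.vertexSection k) (P.vertexTarget k) := by
  intro z hz
  refine ContDiffAt.contDiffWithinAt (contDiffAt_pi.2 fun j => ?_)
  unfold vertexSection
  by_cases h1 : j = k.castSucc
  · simp only [if_pos h1]; exact contDiffAt_fst
  by_cases h2 : j = k.succ
  · simp only [if_neg h1, if_pos h2]; exact contDiffAt_snd
  simp only [if_neg h1, if_neg h2]
  have : ContDiffAt ℝ ∞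
      (fun z => Real.sqrt (2 * (pairing (P.vertexMoment k z) (P.v j) - P.a j))) z := by
    refine ContDiffAt.sqrt ?_ ?_
    · exact (contDiff_const.mul ((P.contDiff_vertexMoment k (P.v j)).sub contDiff_const)).contDiffAt
    · have := hz j h1 h2
      exact ne_of_gt (by linarith)
  exact Complex.ofRealCLM.contDiff.contDiffAt.comp z this

/-- The chart of `M_Δ` at the `k`-th vertex. -/
def vertexChart (k : Fin (m + 1)) : OpenPartialHomeomorph P.Model (ℂ × ℂ) where
  toFun := P.modelCoords k.castSucc k.succ (P.delzant k)
  invFun := P.vertexInv k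
  source := P.vertexSource k
  target := P.vertexTarget k
  map_source' := by
    rintro _ ⟨x, hx, rfl⟩
    exact P.coords_mem hx
  map_target' := fun z hz => by
    rw [P.vertexInv_of_mem hz, quot_mem_vertexSource]
    exact P.vertexSection_ne_zero hz
  left_inv' := by
    rintro _ ⟨x, hx, rfl⟩
    exact (P.vertexInv_of_mem (P.coords_mem hx)).trans (P.vertexSection_coords hx)
  right_inv' := fun z hz => by
    rw [P.vertexInv_of_mem hz]
    exact P.coords_vertexSection hz
  open_source := by
    refine P.isOpenMap_quot _ ?_
    have : {x : P.Level | ∀ j, j ≠ k.castSucc → j ≠ k.succ → x.1 j ≠ 0} =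
        ⋂ j, ⋂ (_ : j ≠ k.castSucc), ⋂ (_ : j ≠ k.succ), {x | x.1 j ≠ 0} := by
      ext x; simp
    rw [this]
    refine isOpen_iInter_of_finite fun j => isOpen_iInter_of_finite fun _ =>
      isOpen_iInter_of_finite fun _ => ?_
    exact isOpen_ne_fun ((continuous_apply j).comp continuous_subtype_val) continuous_const
  open_target := P.isOpen_vertexTarget k
  continuousOn_toFun := by
    have hq : Topology.IsQuotientMap P.quot :=
      P.isOpenMap_quot.isQuotientMap P.continuous_quot P.quot_surjective
    rw [continuousOn_iff_continuous_domRestrict]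
    have hq' := (P.isOpenMap_quot.restrictPreimage (P.vertexSource k)).isQuotientMap
      (P.continuous_quot.restrictPreimage)
      (Set.restrictPreimage_surjective _ P.quot_surjective)
    rw [hq'.continuous_iff]
    have hc := (P.contDiffOn_coords k.castSucc k.succ).continuousOn
    refine hc.comp_continuous
      (f := fun x : P.quot ⁻¹' P.vertexSource k => x.1.1)
      (continuous_subtype_val.comp continuous_subtype_val) fun x => ?_
    exact P.quot_mem_vertexSource.1 x.2
  continuousOn_invFun := by
    rw [continuousOn_iff_continuous_domRestrict]
    have hc := continuousOn_iff_continuous_domRestrict.1 (P.contDiffOn_vertexSection k).continuousOn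
    have : (P.vertexTarget k).domRestrict (P.vertexInv k) = fun z =>
        P.quot ⟨P.vertexSection k z.1, P.vertexSection_mem z.2⟩ :=
      funext fun z => P.vertexInv_of_mem z.2
    rw [this]
    exact P.continuous_quot.comp (hc.subtype_mk _)

/-- If two edges meet in a point of `Δ`, they are adjacent. -/
lemma adjacent_of_mem {w : ℝ × ℝ} (hw : w ∈ P.toSet) {i j : Fin (m + 2)} (hij : i < j)
    (hi : pairing w (P.v i) = P.a i) (hj : pairing w (P.v j) = P.a j) : j.1 = i.1 + 1 := by
  by_contra hne
  have hlt : i.1 + 1 < j.1 := by have := Fin.lt_def.1 hij; omega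
  let l : Fin (m + 2) := ⟨i.1 + 1, by omega⟩
  have hil : i < l := Fin.lt_def.2 (by simp [l])
  have hlj : l < j := Fin.lt_def.2 (by simpa [l] using hlt)
  have dij : (0 : ℝ) < det₂ (P.v i) (P.v j) := by exact_mod_cast P.counterclockwise _ _ hij
  have dil : (0 : ℝ) < det₂ (P.v i) (P.v l) := by exact_mod_cast P.counterclockwise _ _ hil
  have dlj : (0 : ℝ) < det₂ (P.v l) (P.v j) := by exact_mod_cast P.counterclockwise _ _ hlj
  have expand : ∀ x : ℝ × ℝ, (det₂ (P.v i) (P.v j) : ℝ) * pairing x (P.v l) =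
      det₂ (P.v l) (P.v j) * pairing x (P.v i) + det₂ (P.v i) (P.v l) * pairing x (P.v j) := by
    intro x; simp only [det₂, pairing]; push_cast; ring
  have solve : ∀ x : ℝ × ℝ, pairing x (P.v i) = P.a i → pairing x (P.v j) = P.a j → x = w := by
    intro x h1 h2
    rw [← hi] at h1
    rw [← hj] at h2
    simp only [pairing, det₂] at *
    push_cast at dij
    refine Prod.ext ?_ ?_
    · refine mul_left_cancel₀ dij.ne' ?_
      linear_combination ((P.v j).2 : ℝ) * h1 - ((P.v i).2 : ℝ) * h2
    · refine mul_left_cancel₀ dij.ne' ?_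
      linear_combination ((P.v i).1 : ℝ) * h2 - ((P.v j).1 : ℝ) * h1
  have only : ∀ x : ℝ × ℝ, (∀ s, P.a s ≤ pairing x (P.v s)) → pairing x (P.v l) = P.a l →
      x = w := by
    intro x hx hxl
    have e1 := expand x
    have e2 := expand w
    have hwl := hw l
    rw [hi, hj] at e2
    rw [hxl] at e1
    have h1 := hx i
    have h2 := hx j
    have m1 := mul_le_mul_of_nonneg_left hwl dij.le
    have m2 := mul_le_mul_of_nonneg_left h1 dlj.le
    have m3 := mul_le_mul_of_nonneg_left h2 dil.le
    refine solve x ?_ ?_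
    · exact (mul_left_cancel₀ dlj.ne' (by linarith)).symm
    · exact (mul_left_cancel₀ dil.ne' (by linarith)).symm
  obtain ⟨x, hx, y, hy, hxy⟩ := P.nontrivial_edge l
  exact hxy ((only x hx.1 hx.2).trans (only y hy.1 hy.2).symm)

lemma exists_vertexSource (p : P.Model) : ∃ k, p ∈ P.vertexSource k := by
  obtain ⟨x, rfl⟩ := P.quot_surjective p
  simp only [quot_mem_vertexSource]
  set w : ℝ × ℝ := ((1 / 2 : ℝ) * ‖x.1 0‖ ^ 2, (1 / 2 : ℝ) * ‖x.1 (Fin.last (m + 1))‖ ^ 2)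
  have hw : w ∈ P.toSet := fun i => by
    have := P.half_norm_level x i
    have : 0 ≤ (1 / 2 : ℝ) * ‖x.1 i‖ ^ 2 := by positivity
    linarith
  have hz : ∀ i, x.1 i = 0 → pairing w (P.v i) = P.a i := fun i h0 => by
    have := P.half_norm_level x i
    rw [h0] at this
    simp only [norm_zero] at this
    linarith
  by_contra! hcon
  have adj : ∀ i j, i < j → x.1 i = 0 → x.1 j = 0 → j.1 = i.1 + 1 :=
    fun i j hij h1 h2 => P.adjacent_of_mem hw hij (hz i h1) (hz j h2)
  obtain ⟨j₀, -, -, h₀⟩ := hcon 0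
  obtain ⟨i, hi, hmin⟩ : ∃ i, x.1 i = 0 ∧ ∀ j, x.1 j = 0 → i ≤ j := by
    have hne : (Finset.univ.filter fun j => x.1 j = 0).Nonempty := ⟨j₀, by simpa using h₀⟩
    refine ⟨_, (Finset.mem_filter.1 (Finset.min'_mem _ hne)).2, fun j hj => ?_⟩
    exact Finset.min'_le _ _ (by simpa using hj)
  by_cases hl : i.1 < m + 1
  · obtain ⟨j, h1, h2, h3⟩ := hcon ⟨i.1, hl⟩
    have hij : i < j := lt_of_le_of_ne (hmin j h3) fun h => h1 (by ext; simp [h])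
    exact h2 (by ext; simpa using adj i j hij hi h3)
  · obtain ⟨j, h1, h2, h3⟩ := hcon (Fin.last m)
    have := Fin.le_def.1 (hmin j h3)
    exact h2 (by ext; simp; omega)

instance : ChartedSpace (ℂ × ℂ) P.Model where
  atlas := Set.range P.vertexChart
  chartAt p := P.vertexChart (Classical.choose (P.exists_vertexSource p))
  mem_chart_source p := Classical.choose_spec (P.exists_vertexSource p)
  chart_mem_atlas _ := ⟨_, rfl⟩

instance : IsManifold 𝓘(ℝ, ℂ × ℂ) ∞ P.Model := by
  refine isManifold_of_contDiffOn _ _ _ ?_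
  rintro _ _ ⟨k, rfl⟩ ⟨l, rfl⟩
  have key : ContDiffOn ℝ ∞ (fun z => P.coords l.castSucc l.succ (P.vertexSection k z))
      (P.vertexTarget k ∩ P.vertexInv k ⁻¹' P.vertexSource l) := by
    refine (P.contDiffOn_coords _ _).comp
      ((P.contDiffOn_vertexSection k).mono Set.inter_subset_left) ?_
    rintro z ⟨hz, hz'⟩
    rw [Set.mem_preimage, P.vertexInv_of_mem hz, quot_mem_vertexSource] at hz'
    exact hz'
  refine (key.congr ?_).mono (fun z hz => hz.1)
  rintro z ⟨hz, -⟩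
  change P.modelCoords _ _ (P.delzant l) (P.vertexInv k z) = _
  rw [P.vertexInv_of_mem hz]
  rfl

/-! #### The reduced symplectic form -/

/-- The standard symplectic form `∑ⱼ dxⱼ ∧ dyⱼ = (i / 2) ∑ⱼ dzⱼ ∧ dz̄ⱼ` on `ℂⁿ`. -/
def stdForm (n : ℕ) : (Fin n → ℂ) →L[ℝ] (Fin n → ℂ) →L[ℝ] ℝ :=
  ∑ j, ((Complex.reCLM.smulRight Complex.imCLM - Complex.imCLM.smulRight Complex.reCLM :
    ℂ →L[ℝ] ℂ →L[ℝ] ℝ)).bilinearComp (ContinuousLinearMap.proj j) (ContinuousLinearMap.proj j)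

/-- The reduced form on `M_Δ`, that is, the form whose pull-back to `U_Δ` is the restriction of the
standard form. On the domain of a chart, `vertexSection` is a section of `U_Δ → M_Δ`, so that the
reduced form is the pull-back of the standard form under it. -/
def modelForm : BilinField P.Model := fun p =>
  let k := Classical.choose (P.exists_vertexSource p)
  let d : (ℂ × ℂ) →L[ℝ] (Fin (m + 2) → ℂ) :=
    fderiv ℝ (P.vertexSection k) (P.modelCoords k.castSucc k.succ (P.delzant k) p)
  let b : (ℂ × ℂ) →L[ℝ] (ℂ × ℂ) →L[ℝ] ℝ := (stdForm (m + 2)).bilinearComp d d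
  b

/-! ### Corner manifolds with a given moment image -/

section Identification

variable {N : Type*} [TopologicalSpace N] [ChartedSpace (ℂ × ℂ) N] [MulAction (Circle × Circle) N]

/-- An identification of a corner manifold `N` with `M_Δ`: an equivariant symplectomorphism that
intertwines the moment maps. -/
structure Identification (Ω : BilinField N) (Φ : N → ℝ × ℝ) where
  toDiffeo : N ≃ₘ⟮𝓘(ℝ, ℂ × ℂ), 𝓘(ℝ, ℂ × ℂ)⟯ P.Model
  equivariant : ∀ (g : Circle × Circle) (p : N), toDiffeo (g • p) = g • toDiffeo p
  moment : ∀ p, P.modelMoment (toDiffeo p) = Φ p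
  symplectic : ∀ (p : N) (u v : TangentSpace 𝓘(ℝ, ℂ × ℂ) p),
    P.modelForm (toDiffeo p) (mfderiv 𝓘(ℝ, ℂ × ℂ) 𝓘(ℝ, ℂ × ℂ) toDiffeo p u)
      (mfderiv 𝓘(ℝ, ℂ × ℂ) 𝓘(ℝ, ℂ × ℂ) toDiffeo p v) = Ω p u v

/-- The symplectic blowup map `ψ : N ∖ D → ℂ²` of a corner manifold identified with `M_Δ`, as a
total function whose values on `D` are irrelevant. -/
def Identification.blowup {P : CornerPolyhedron m} {Ω : BilinField N} {Φ : N → ℝ × ℝ} (ι : P.Identification Ω Φ) (p : N) :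
    ℂ × ℂ :=
  P.modelBlowup (ι.toDiffeo p)

end Identification

section Chain

variable {N : Type*} (Φ : N → ℝ × ℝ)

/-- The set `S_i = {p | ⟨Φ p, v_i⟩ = a_i}`. -/
def sphere (i : Fin (m + 2)) : Set N := {p | pairing (Φ p) (P.v i) = P.a i}

/-- The chain `D` of isotropy spheres, the union of the `S_i` where `i` is neither the first nor
the last index. -/
def chain : Set N := ⋃ i ∈ {i : Fin (m + 2) | i ≠ 0 ∧ i ≠ Fin.last (m + 1)}, P.sphere Φ i

end Chain

end CornerPolyhedron

/-- The preimage under the moment map of the triangle `w₁ ≥ 0`, `w₂ ≥ 0`, `w₁ + w₂ < ε`. -/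
def triangular {N : Type*} (Φ : N → ℝ × ℝ) (ε : ℝ) : Set N :=
  Φ ⁻¹' {w | 0 ≤ w.1 ∧ 0 ≤ w.2 ∧ w.1 + w.2 < ε}

end

open scoped ComplexConjugate

noncomputable section

/-! On ℂ² write p = z₁ and q = conj z₂. The anti-diagonal circle acts on (p, q) by scalars, and |p|²
+ |q|² is twice the diagonal moment s. Hence every unitary matrix in (p, q) commutes with the
anti-diagonal circle and preserves s. The swap of p and q has eigenvalues 1 and -1; replacing -1 by
c in the unit circle gives a path of unitary matrices from the swap (c = -1) to the identity (c =
1). Letting c depend on s yields a diffeomorphism of ℂ² (`rotation`), whose inverse belongs to conj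
c.

Near the chain D, complex conjugation combined with reversal of the coordinates, x ↦ (conj xₙ, …,
conj x₁), descends to a map of reduced spaces that carries S_i to S'_{n+1-i}. It is anti-symplectic,
so in dimension 4 it preserves the orientation, and away from D the blowup maps turn it into the
swap. The mirror diffeomorphism therefore uses c = -1 for s < b and c = 1 for s ≥ β, where b < β
still bounds s on the middle edges; such a b exists by compactness (`exists_bound_of_middleEdges`).

To avoid gluing, both regimes are given by one formula on the level sets, `twist`. The middle
coordinates get the conjugate, reversed phases. The outer two are rotated, with a phase factor μ =
`twistPhase` that makes the map compatible with K and makes it cover `rotation` (`coords_twist`).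
The moduli of the middle coordinates are then forced by the level equations. They stay positive for
s ≥ b because every point of the quadrant with coordinate sum at least b lies strictly inside all
middle half planes (`lt_pairing_of_bound`) and the twist preserves s. This gives smoothness for s ≥
b, and `twist_twist` supplies the inverse.

For the orientation, `planeForm_fderiv_coords` shows that every map `coords i i'` with determinant 1
is symplectic on the reduced space, in particular the vertex charts and the blowup map. For s < b
the twist negates the form. For s ≥ b it is conjugate to `rotation`, which preserves the volume
though not the form, being a shear along the angle in the coordinates p + q, p - q
(`planeVol_fderiv_rotation`). -/

namespace CornerPolyhedron

variable {m : ℕ}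

/-! ### Mirror pairs -/

/-- `Q` is the reflection of `P` across the diagonal. -/
structure IsMirror (P Q : CornerPolyhedron m) : Prop where
  v : ∀ i, Q.v i = (P.v i.rev).swap
  a : ∀ i, Q.a i = P.a i.rev

lemma isMirror_mirror (P : CornerPolyhedron m) : P.IsMirror P.mirror := ⟨fun _ => rfl, fun _ => rfl⟩

/-- Being mirror images is treated as a symmetric relation, so that each statement about the twist
also applies to its inverse with `P` and `Q` exchanged. -/
lemma IsMirror.symm {P Q : CornerPolyhedron m} (h : P.IsMirror Q) : Q.IsMirror P :=
  ⟨fun i => by rw [h.v, Fin.rev_rev, Prod.swap_swap], fun i => by rw [h.a, Fin.rev_rev]⟩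

lemma IsMirror.pairing_sub {P Q : CornerPolyhedron m} (h : P.IsMirror Q) (w : ℝ × ℝ)
    (j : Fin (m + 2)) :
    pairing w (Q.v j) - Q.a j = pairing w.swap (P.v j.rev) - P.a j.rev := by
  rw [h.v, h.a]
  simp only [pairing, Prod.fst_swap, Prod.snd_swap]
  ring

/-- The indices other than the first and the last. -/
abbrev middle (m : ℕ) : Finset (Fin (m + 2)) := {0, Fin.last (m + 1)}ᶜ

lemma mem_middle {j : Fin (m + 2)} : j ∈ middle m ↔ j ≠ 0 ∧ j ≠ Fin.last (m + 1) := by simp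

lemma rev_mem_middle {j : Fin (m + 2)} : j.rev ∈ middle m ↔ j ∈ middle m := by
  rw [mem_middle, mem_middle, Ne, Ne, Fin.rev_eq_iff, Fin.rev_eq_iff, Fin.rev_last, Fin.rev_zero,
    and_comm]

lemma prod_middle_rev {M : Type*} [CommMonoid M] (f : Fin (m + 2) → M) :
    ∏ j ∈ middle m, f j.rev = ∏ j ∈ middle m, f j :=
  Finset.prod_bij' (fun j _ => j.rev) (fun j _ => j.rev) (fun _ h => rev_mem_middle.2 h)
    (fun _ h => rev_mem_middle.2 h) (fun _ _ => Fin.rev_rev _) (fun _ _ => Fin.rev_rev _)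
    (fun _ _ => rfl)

/-! ### The twist of the level sets -/

/-- A smooth function to the unit circle that is `-1` on `(-∞, b)`, where `b` is such that no
points of the quadrant with coordinate sum at least `b` lie on or beyond a middle edge. -/
structure TwistProfile (P : CornerPolyhedron m) (b : ℝ) (c : ℝ → ℂ) : Prop where
  smooth : ContDiff ℝ ∞ c
  norm_eq : ∀ s, ‖c s‖ = 1
  eq_neg_one : ∀ s, s < b → c s = -1
  interior : ∀ w : ℝ × ℝ, 0 ≤ w.1 → 0 ≤ w.2 → b ≤ w.1 + w.2 →
    ∀ j ∈ middle m, P.a j < pairing w (P.v j)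

/-- The inverse of a unitary matrix with eigenvalues 1 and c has eigenvalues 1 and conj c, so this
is the profile of the inverse twist. The interior condition carries over because the coordinate sum
is invariant under reflection. -/
lemma TwistProfile.conj {P Q : CornerPolyhedron m} (h : P.IsMirror Q) {b : ℝ} {c : ℝ → ℂ}
    (hc : P.TwistProfile b c) : Q.TwistProfile b (fun s => conj (c s)) where
  smooth := Complex.conjCLE.contDiff.comp hc.smooth
  norm_eq s := by rw [Complex.norm_conj, hc.norm_eq]
  eq_neg_one s hs := by simp [hc.eq_neg_one s hs]
  interior w h1 h2 h3 j hj := by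
    have := hc.interior w.swap h2 h1 (by simpa [add_comm] using h3) j.rev (rev_mem_middle.2 hj)
    have := h.pairing_sub w j
    linarith

/-- The moment map of the diagonal circle on `ℂⁿ`. -/
def diagMoment (x : Fin (m + 2) → ℂ) : ℝ := (1 / 2 : ℝ) * (‖x 0‖ ^ 2 + ‖x (Fin.last (m + 1))‖ ^ 2)

variable (P Q : CornerPolyhedron m) (c : ℝ → ℂ)

/-- The product of the phases of the middle coordinates, with exponents `α_j + β_j`. -/
def twistPhase (x : Fin (m + 2) → ℂ) : ℂ :=
  ∏ j ∈ middle m, (x j / ‖x j‖) ^ ((P.v j).1 + (P.v j).2)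

/-- The first coordinate of the twist. -/
def twistFirst (x : Fin (m + 2) → ℂ) : ℂ :=
  (1 / 2) * ((1 + c (diagMoment x)) * (P.twistPhase x * x 0)
    + (1 - c (diagMoment x)) * conj (x (Fin.last (m + 1))))

/-- The last coordinate of the twist. -/
def twistLast (x : Fin (m + 2) → ℂ) : ℂ :=
  (1 / 2) * ((1 - conj (c (diagMoment x))) * conj (x 0)
    + (1 + conj (c (diagMoment x))) * (P.twistPhase x * x (Fin.last (m + 1))))

/-- The square of the absolute value of the `j.rev`-th coordinate of the twist. -/
def twistNormSq (x : Fin (m + 2) → ℂ) (j : Fin (m + 2)) : ℝ :=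
  ‖x j‖ ^ 2 + (‖P.twistLast c x‖ ^ 2 - ‖x 0‖ ^ 2) * (P.v j).1
    + (‖P.twistFirst c x‖ ^ 2 - ‖x (Fin.last (m + 1))‖ ^ 2) * (P.v j).2

/-- A lift of the mirror diffeomorphism to the level sets. Where `c = -1` it is the complex
conjugation followed by the reversal of the coordinates, and where `c = 1` it covers the identity
under the blowup maps. -/
def twist (x : Fin (m + 2) → ℂ) (j : Fin (m + 2)) : ℂ :=
  if j = 0 then P.twistFirst c x else if j = Fin.last (m + 1) then P.twistLast c x else
    conj (x j.rev / ‖x j.rev‖) * (Real.sqrt (P.twistNormSq c x j.rev) : ℂ)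

lemma last_ne_zero : Fin.last (m + 1) ≠ 0 := (Fin.last_pos).ne'

@[simp] lemma twist_zero (x : Fin (m + 2) → ℂ) : P.twist c x 0 = P.twistFirst c x := if_pos rfl

@[simp] lemma twist_last (x : Fin (m + 2) → ℂ) :
    P.twist c x (Fin.last (m + 1)) = P.twistLast c x := by
  rw [twist, if_neg last_ne_zero, if_pos rfl]

lemma twist_middle (x : Fin (m + 2) → ℂ) {j : Fin (m + 2)} (hj : j ∈ middle m) :
    P.twist c x j = conj (x j.rev / ‖x j.rev‖) * (Real.sqrt (P.twistNormSq c x j.rev) : ℂ) := by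
  rw [twist, if_neg (mem_middle.1 hj).1, if_neg (mem_middle.1 hj).2]

variable {P Q c}

/-- Where `c = -1`, the twist is the conjugate reversal. -/
lemma twist_of_eq_neg_one {x : Fin (m + 2) → ℂ} (h : c (diagMoment x) = -1) (j : Fin (m + 2)) :
    P.twist c x j = conj (x j.rev) := by
  have h0 : P.twistFirst c x = conj (x (Fin.last (m + 1))) := by
    rw [twistFirst, h]; ring
  have h1 : P.twistLast c x = conj (x 0) := by
    rw [twistLast, h]; simp; ring
  by_cases hj0 : j = 0
  · subst hj0; rw [twist_zero, h0, Fin.rev_zero]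
  by_cases hj1 : j = Fin.last (m + 1)
  · subst hj1; rw [twist_last, h1, Fin.rev_last]
  rw [twist_middle _ _ _ (mem_middle.2 ⟨hj0, hj1⟩), twistNormSq, h0, h1]
  simp only [Complex.norm_conj, sub_self, zero_mul, add_zero, Real.sqrt_sq (norm_nonneg _)]
  by_cases hx : x j.rev = 0
  · simp [hx]
  · have : (‖x j.rev‖ : ℂ) ≠ 0 := by simpa using hx
    rw [map_div₀, Complex.conj_ofReal, div_mul_cancel₀ _ this]

lemma norm_twistPhase {x : Fin (m + 2) → ℂ} (hx : ∀ j ∈ middle m, x j ≠ 0) :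
    ‖P.twistPhase x‖ = 1 := by
  rw [twistPhase, coe_prod_phase hx, Circle.norm_coe]

lemma sq_norm_eq (z : ℂ) : ‖z‖ ^ 2 = z.re * z.re + z.im * z.im := by
  rw [Complex.sq_norm, Complex.normSq_apply]

/-- A unitary matrix with eigenvalues `1` and `c` preserves the norm. -/
lemma norm_rotation {c : ℂ} (hc : ‖c‖ = 1) (p q : ℂ) :
    ‖(1 / 2) * ((1 + c) * p + (1 - c) * q)‖ ^ 2 + ‖(1 / 2) * ((1 - c) * p + (1 + c) * q)‖ ^ 2
      = ‖p‖ ^ 2 + ‖q‖ ^ 2 := by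
  have h : c.re * c.re + c.im * c.im = 1 := by rw [← sq_norm_eq, hc]; norm_num
  simp only [sq_norm_eq, Complex.mul_re, Complex.mul_im, Complex.add_re, Complex.add_im,
    Complex.sub_re, Complex.sub_im, Complex.one_re, Complex.one_im, Complex.div_ofNat_re,
    Complex.div_ofNat_im]
  linear_combination (1 / 2 : ℝ) * ((p.re - q.re) ^ 2 + (p.im - q.im) ^ 2) * h

/-- The twist preserves the moment map of the diagonal circle. -/
lemma diagMoment_twist {x : Fin (m + 2) → ℂ} (hc : ‖c (diagMoment x)‖ = 1)
    (h : c (diagMoment x) = -1 ∨ ∀ j ∈ middle m, x j ≠ 0) :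
    diagMoment (P.twist c x) = diagMoment x := by
  rcases h with h | h
  · rw [diagMoment, twist_of_eq_neg_one h, twist_of_eq_neg_one h, Fin.rev_zero, Fin.rev_last,
      Complex.norm_conj, Complex.norm_conj, add_comm, diagMoment]
  · have hμ := norm_twistPhase (P := P) h
    have hμ' : P.twistPhase x * conj (P.twistPhase x) = 1 := by
      rw [Complex.mul_conj']; simp [hμ]
    set c' := c (diagMoment x) with hc'
    -- Up to conjugation and the unit factor μ, the last coordinate is the second component of the
    -- unitary matrix applied to p = μ x₁, q = conj xₙ; the first coordinate is the first component.
    have e : ‖P.twistLast c x‖ = ‖(1 / 2) * ((1 - c') * (P.twistPhase x * x 0)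
        + (1 + c') * conj (x (Fin.last (m + 1))))‖ := by
      have : P.twistLast c x = P.twistPhase x * conj ((1 / 2) * ((1 - c') * (P.twistPhase x * x 0)
        + (1 + c') * conj (x (Fin.last (m + 1))))) := by
        simp only [twistLast, ← hc', map_mul, map_add, map_sub, map_one, Complex.conj_conj,
          map_div₀, Complex.conj_ofNat]
        linear_combination (-(1 / 2) * (1 - conj c') * conj (x 0)) * hμ'
      rw [this, norm_mul, hμ, one_mul, Complex.norm_conj]
    rw [diagMoment, twist_zero, twist_last, e, twistFirst, norm_rotation hc, norm_mul, hμ, one_mul,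
      Complex.norm_conj, diagMoment]

lemma diagMoment_eq (x : Fin (m + 2) → ℂ) : diagMoment x =
    (1 / 2 : ℝ) * ‖x 0‖ ^ 2 + (1 / 2 : ℝ) * ‖x (Fin.last (m + 1))‖ ^ 2 := by
  rw [diagMoment]; ring

/-! ### Zeros and moduli of the twist on the level set -/

namespace TwistProfile

variable {b : ℝ} (hc : P.TwistProfile b c)
include hc

/-- A zero of `x j` puts the moment of `x` on the j-th edge, which has no points with coordinate sum
at least `b`. -/
lemma level_ne_zero (x : P.Level) (hx : b ≤ diagMoment x.1) : ∀ j ∈ middle m, x.1 j ≠ 0 := by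
  intro j hj h0
  have h := P.half_norm_level x j
  have := hc.interior ((1 / 2 : ℝ) * ‖x.1 0‖ ^ 2, (1 / 2 : ℝ) * ‖x.1 (Fin.last (m + 1))‖ ^ 2)
    (by positivity) (by positivity) (by rw [← diagMoment_eq]; exact hx) j hj
  rw [h0, norm_zero] at h
  linarith

lemma eq_neg_one_or (x : P.Level) : c (diagMoment x.1) = -1 ∨ ∀ j ∈ middle m, x.1 j ≠ 0 :=
  (lt_or_ge (diagMoment x.1) b).imp (hc.eq_neg_one _) (hc.level_ne_zero x)

lemma diagMoment_twist (x : P.Level) : diagMoment (P.twist c x.1) = diagMoment x.1 :=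
  CornerPolyhedron.diagMoment_twist (hc.norm_eq _) (hc.eq_neg_one_or x)

omit hc in
lemma twistNormSq_eq (x : P.Level) (j : Fin (m + 2)) : P.twistNormSq c x.1 j =
    2 * (pairing ((1 / 2 : ℝ) * ‖P.twistLast c x.1‖ ^ 2, (1 / 2 : ℝ) * ‖P.twistFirst c x.1‖ ^ 2)
      (P.v j) - P.a j) := by
  have := P.half_norm_level x j
  simp only [twistNormSq, pairing] at *
  linear_combination 2 * this

/-- By `twistNormSq_eq` the quantity is twice the slack of the j-th inequality of `P` at the
reflected new moment. The coordinate sum there is still at least `b`, so the interior condition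
applies. -/
lemma twistNormSq_pos (x : P.Level) (hx : b ≤ diagMoment x.1) {j : Fin (m + 2)}
    (hj : j ∈ middle m) : 0 < P.twistNormSq c x.1 j := by
  rw [twistNormSq_eq]
  have := hc.interior ((1 / 2 : ℝ) * ‖P.twistLast c x.1‖ ^ 2,
    (1 / 2 : ℝ) * ‖P.twistFirst c x.1‖ ^ 2) (by positivity) (by positivity) (by
      rw [← hc.diagMoment_twist x, diagMoment_eq, twist_zero, twist_last] at hx
      linarith) j hj
  linarith

lemma norm_twist_middle (x : P.Level) {j : Fin (m + 2)} (hj : j ∈ middle m) :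
    ‖P.twist c x.1 j‖ ^ 2 = P.twistNormSq c x.1 j.rev := by
  rcases lt_or_ge (diagMoment x.1) b with h | h
  · have h1 := twist_of_eq_neg_one (P := P) (hc.eq_neg_one _ h)
    have h2 := h1 0
    have h3 := h1 (Fin.last (m + 1))
    rw [twist_zero, Fin.rev_zero] at h2
    rw [twist_last, Fin.rev_last] at h3
    rw [h1, twistNormSq, h2, h3]
    simp
  · have hj' := rev_mem_middle.2 hj
    rw [twist_middle _ _ _ hj, norm_mul, Complex.norm_conj, ← coe_phase (hc.level_ne_zero x h _ hj'),
      Circle.norm_coe, one_mul, Complex.norm_real, Real.norm_eq_abs, sq_abs,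
      Real.sq_sqrt (hc.twistNormSq_pos x h hj').le]

lemma twistNormSq_pos_of_ne_zero (x : P.Level) {j : Fin (m + 2)} (hj : j ∈ middle m)
    (h0 : x.1 j ≠ 0) : 0 < P.twistNormSq c x.1 j := by
  rcases lt_or_ge (diagMoment x.1) b with h | h
  · have h1 := hc.norm_twist_middle x (rev_mem_middle.2 hj)
    rw [twist_of_eq_neg_one (hc.eq_neg_one _ h), Fin.rev_rev, Complex.norm_conj] at h1
    rw [← h1]
    exact pow_pos (norm_pos_iff.2 h0) 2
  · exact hc.twistNormSq_pos x h hj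

lemma twist_eq_zero_iff (x : P.Level) {j : Fin (m + 2)} (hj : j ∈ middle m) :
    P.twist c x.1 j = 0 ↔ x.1 j.rev = 0 := by
  rcases lt_or_ge (diagMoment x.1) b with h | h
  · rw [twist_of_eq_neg_one (P := P) (hc.eq_neg_one _ h), map_eq_zero]
  · have hj' := rev_mem_middle.2 hj
    refine iff_of_false (fun h0 => ?_) (hc.level_ne_zero x h _ hj')
    have h1 := hc.norm_twist_middle x hj
    have := hc.twistNormSq_pos x h hj'
    rw [h0, norm_zero] at h1
    linarith

lemma twist_mem (hPQ : P.IsMirror Q) (x : P.Level) (i : Fin (m + 2)) :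
    (1 / 2 : ℝ) * ((Q.v i).1 * ‖P.twist c x.1 0‖ ^ 2 - ‖P.twist c x.1 i‖ ^ 2 +
      (Q.v i).2 * ‖P.twist c x.1 (Fin.last (m + 1))‖ ^ 2) = Q.a i := by
  by_cases h0 : i = 0
  · subst h0; simp [Q.v_first, Q.a_first]
  by_cases h1 : i = Fin.last (m + 1)
  · subst h1; simp [Q.v_last, Q.a_last]
  rw [hc.norm_twist_middle x (mem_middle.2 ⟨h0, h1⟩), twistNormSq_eq, hPQ.v, hPQ.a, twist_zero,
    twist_last]
  simp only [pairing, Prod.fst_swap, Prod.snd_swap]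
  ring

/-- The twist as a map of level sets. -/
def levelMap (hPQ : P.IsMirror Q) (x : P.Level) : Q.Level :=
  ⟨P.twist c x.1, hc.twist_mem hPQ x⟩

end TwistProfile

/-- The middle phases are conjugated and reversed, and the exponent α_j + β_j is unchanged by the
exchange of α and β in the mirror. -/
lemma twistPhase_twist (hPQ : P.IsMirror Q) {b : ℝ} (hc : P.TwistProfile b c) (x : P.Level)
    (hx : b ≤ diagMoment x.1) : Q.twistPhase (P.twist c x.1) = conj (P.twistPhase x.1) := by
  rw [twistPhase, twistPhase, ← prod_middle_rev, map_prod]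
  refine Finset.prod_congr rfl fun j hj => ?_
  have hj' := rev_mem_middle.2 hj
  have hp := hc.twistNormSq_pos x hx hj
  have hs : 0 < Real.sqrt (P.twistNormSq c x.1 j) := Real.sqrt_pos.2 hp
  rw [twist_middle _ _ _ hj', Fin.rev_rev, norm_mul, Complex.norm_conj,
    ← coe_phase (hc.level_ne_zero x hx _ hj), Circle.norm_coe, one_mul, Complex.norm_real,
    Real.norm_eq_abs, abs_of_pos hs, mul_div_assoc, div_self (by exact_mod_cast hs.ne'), mul_one,
    map_zpow₀, hPQ.v, Fin.rev_rev, Prod.fst_swap, Prod.snd_swap, add_comm (P.v j).1]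

/-- The twists of `P` and `Q` for conjugate profiles are inverse to each other. -/
lemma twist_twist (hPQ : P.IsMirror Q) {b : ℝ} (hc : P.TwistProfile b c) (x : P.Level) :
    Q.twist (fun s => conj (c s)) (P.twist c x.1) = x.1 := by
  have hs := hc.diagMoment_twist x
  funext j
  rcases lt_or_ge (diagMoment x.1) b with h | h
  · have h1 := hc.eq_neg_one _ h
    rw [twist_of_eq_neg_one (by rw [hs, h1]; simp), twist_of_eq_neg_one h1, Complex.conj_conj,
      Fin.rev_rev]
  have hμ : P.twistPhase x.1 * conj (P.twistPhase x.1) = 1 := by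
    rw [Complex.mul_conj']; simp [norm_twistPhase (hc.level_ne_zero x h)]
  have hcc : c (diagMoment x.1) * conj (c (diagMoment x.1)) = 1 := by
    rw [Complex.mul_conj']; simp [hc.norm_eq]
  -- The matrices for c and conj c are mutually inverse, and the phase factors cancel by |μ| = 1.
  -- The remaining terms cancel by |c| = 1.
  have e0 : Q.twistFirst (fun s => conj (c s)) (P.twist c x.1) = x.1 0 := by
    rw [twistFirst, hs, twistPhase_twist hPQ hc x h, twist_zero, twist_last, twistFirst, twistLast]
    simp only [map_mul, map_add, map_sub, map_one, Complex.conj_conj, map_div₀, Complex.conj_ofNat]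
    linear_combination
      ((1 + conj (c (diagMoment x.1))) * (1 + c (diagMoment x.1)) / 4 * x.1 0) * hμ
      + ((1 / 2) * x.1 0
        - (1 / 2) * conj (P.twistPhase x.1) * conj (x.1 (Fin.last _))) * hcc
  have e1 : Q.twistLast (fun s => conj (c s)) (P.twist c x.1) = x.1 (Fin.last (m + 1)) := by
    rw [twistLast, hs, twistPhase_twist hPQ hc x h, twist_zero, twist_last, twistFirst, twistLast]
    simp only [map_mul, map_add, map_sub, map_one, Complex.conj_conj, map_div₀, Complex.conj_ofNat]
    linear_combination
      ((1 + conj (c (diagMoment x.1))) * (1 + c (diagMoment x.1)) / 4 * x.1 (Fin.last _)) * hμ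
      + ((1 / 2) * x.1 (Fin.last _)
        - (1 / 2) * conj (P.twistPhase x.1) * conj (x.1 0)) * hcc
  by_cases hj0 : j = 0
  · subst hj0; rw [twist_zero, e0]
  by_cases hj1 : j = Fin.last (m + 1)
  · subst hj1; rw [twist_last, e1]
  have hj := mem_middle.2 ⟨hj0, hj1⟩
  have hj' := rev_mem_middle.2 hj
  have hn : (‖x.1 j‖ : ℂ) ≠ 0 := by simpa using hc.level_ne_zero x h j hj
  have hsq : 0 < Real.sqrt (P.twistNormSq c x.1 j) := Real.sqrt_pos.2 (hc.twistNormSq_pos x h hj)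
  -- Once the two outer coordinates are restored, the corrections to the squared modulus made by the
  -- two twists are opposite.
  have e2 : Q.twistNormSq (fun s => conj (c s)) (P.twist c x.1) j.rev = ‖x.1 j‖ ^ 2 := by
    rw [twistNormSq, e0, e1, hc.norm_twist_middle x hj', Fin.rev_rev, twist_zero, twist_last,
      hPQ.v, Fin.rev_rev, twistNormSq]
    simp only [Prod.fst_swap, Prod.snd_swap]
    ring
  rw [twist_middle _ _ _ hj, e2, Real.sqrt_sq (norm_nonneg _), twist_middle _ _ _ hj', Fin.rev_rev,
    norm_mul, Complex.norm_conj, ← coe_phase (hc.level_ne_zero x h _ hj), Circle.norm_coe, one_mul,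
    Complex.norm_real, Real.norm_eq_abs, abs_of_pos hsq, mul_div_assoc,
    div_self (by exact_mod_cast hsq.ne'), mul_one, Complex.conj_conj,
    coe_phase (hc.level_ne_zero x h _ hj), div_mul_cancel₀ _ hn]

variable {b : ℝ}

/-! ### Smoothness of the twist -/

lemma contDiff_coord (j : Fin (m + 2)) : ContDiff ℝ ∞ (fun x : Fin (m + 2) → ℂ => x j) :=
  contDiff_apply ℝ ℂ j

lemma contDiff_diagMoment : ContDiff ℝ ∞ (diagMoment (m := m)) :=
  contDiff_const.mul (((contDiff_coord _).norm_sq ℝ).add ((contDiff_coord _).norm_sq ℝ))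

lemma contDiffAt_phase {x : Fin (m + 2) → ℂ} {j : Fin (m + 2)} (hx : x j ≠ 0) :
    ContDiffAt ℝ ∞ (fun y : Fin (m + 2) → ℂ => y j / ‖y j‖) x := by
  have ap := (contDiff_coord j).contDiffAt (x := x)
  have n1 : ContDiffAt ℝ ∞ (fun y : Fin (m + 2) → ℂ => ‖y j‖⁻¹) x :=
    (ap.norm ℝ hx).inv (norm_ne_zero_iff.2 hx)
  refine (n1.smul ap).congr_of_eventuallyEq (Filter.Eventually.of_forall fun y => ?_)
  simp [div_eq_inv_mul]

lemma contDiffAt_twistPhase {x : Fin (m + 2) → ℂ} (hx : ∀ j ∈ middle m, x j ≠ 0) :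
    ContDiffAt ℝ ∞ P.twistPhase x := by
  refine contDiffAt_prod fun j hj => ?_
  have hn : (‖x j‖ : ℂ) ≠ 0 := by simpa using hx j hj
  have z : ContDiffAt ℝ ∞ (fun y : ℂ => y ^ ((P.v j).1 + (P.v j).2)) (x j / ‖x j‖) :=
    ((analyticAt_id.zpow (div_ne_zero (hx j hj) hn)).contDiffAt (𝕜 := ℂ)).restrict_scalars ℝ
  exact z.comp x (contDiffAt_phase (hx j hj))

lemma _root_.ContDiffAt.conj_complex {E : Type*} [NormedAddCommGroup E] [NormedSpace ℝ E] {f : E → ℂ} {x : E}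
    (hf : ContDiffAt ℝ ∞ f x) :
    ContDiffAt ℝ ∞ (fun y => conj (f y)) x :=
  (Complex.conjCLE.contDiff.contDiffAt (x := f x)).comp x hf

/-- The condition s < b is open, so there the twist is locally the conjugate reversal, smooth even
at zeros of middle coordinates. For s ≥ b the middle coordinates and the radicands are nonzero, so
phases and square roots are smooth at the point. -/
lemma TwistProfile.contDiffAt_twist (hc : P.TwistProfile b c) (x : P.Level) :
    ContDiffAt ℝ ∞ (P.twist c) x.1 := by
  rcases lt_or_ge (diagMoment x.1) b with h | h
  · have hev : ∀ᶠ y in 𝓝 x.1, P.twist c y = fun j => conj (y j.rev) := by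
      filter_upwards [contDiff_diagMoment.continuous.continuousAt.eventually_lt_const h] with y hy
      exact funext (twist_of_eq_neg_one (hc.eq_neg_one _ hy))
    refine ContDiffAt.congr_of_eventuallyEq ?_ hev
    exact contDiffAt_pi.2 fun j => (contDiff_coord _).contDiffAt.conj_complex
  · have hx := hc.level_ne_zero x h
    have hμ := contDiffAt_twistPhase (P := P) hx
    have hcs : ContDiffAt ℝ ∞ (fun y : Fin (m + 2) → ℂ => c (diagMoment y)) x.1 :=
      (hc.smooth.comp contDiff_diagMoment).contDiffAt
    have h0 : ContDiffAt ℝ ∞ (fun y : Fin (m + 2) → ℂ => y 0) x.1 := (contDiff_coord _).contDiffAt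
    have h1 : ContDiffAt ℝ ∞ (fun y : Fin (m + 2) → ℂ => y (Fin.last (m + 1))) x.1 :=
      (contDiff_coord _).contDiffAt
    have hF : ContDiffAt ℝ ∞ (P.twistFirst c) x.1 :=
      contDiffAt_const.mul (((contDiffAt_const.add hcs).mul (hμ.mul h0)).add
        ((contDiffAt_const.sub hcs).mul h1.conj_complex))
    have hL : ContDiffAt ℝ ∞ (P.twistLast c) x.1 :=
      contDiffAt_const.mul (((contDiffAt_const.sub hcs.conj_complex).mul h0.conj_complex).add
        ((contDiffAt_const.add hcs.conj_complex).mul (hμ.mul h1)))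
    refine contDiffAt_pi.2 fun j => ?_
    by_cases hj0 : j = 0
    · subst hj0; simpa only [twist_zero] using hF
    by_cases hj1 : j = Fin.last (m + 1)
    · subst hj1; simpa only [twist_last] using hL
    have hj := mem_middle.2 ⟨hj0, hj1⟩
    have hj' := rev_mem_middle.2 hj
    simp only [twist_middle _ _ _ hj]
    have hN : ContDiffAt ℝ ∞ (fun y => P.twistNormSq c y j.rev) x.1 :=
      ((((contDiff_coord _).norm_sq ℝ).contDiffAt).add
        (((hL.norm_sq ℝ).sub (h0.norm_sq ℝ)).mul contDiffAt_const)).add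
        (((hF.norm_sq ℝ).sub (h1.norm_sq ℝ)).mul contDiffAt_const)
    have hS := hN.sqrt (hc.twistNormSq_pos x h hj').ne'
    exact (contDiffAt_phase (hx _ hj')).conj_complex.mul
      ((Complex.ofRealCLM.contDiff.contDiffAt).comp x.1 hS)

/-! ### Equivariance of the twist and the induced map of the reduced spaces -/

/-- The effect of the twist on the torus. -/
def torusRev (k : Fin (m + 2) → Circle) : Fin (m + 2) → Circle := fun j => (k j.rev)⁻¹

/-- Reversal exchanges α and β, hence the two equations defining K. -/
lemma torusRev_mem (hPQ : P.IsMirror Q) {k : Fin (m + 2) → Circle} (hk : k ∈ P.K) :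
    torusRev k ∈ Q.K := by
  have key : ∀ f : Fin (m + 2) → ℤ, ∏ i : Fin (m + 2), (k i.rev)⁻¹ ^ f i.rev = (∏ i, k i ^ f i)⁻¹ := by
    intro f
    rw [← Finset.prod_inv_distrib]
    exact Fintype.prod_equiv Fin.revPerm _ _ fun i => by simp
  constructor
  · simp only [torusRev, hPQ.v, Prod.fst_swap]
    rw [key fun i => (P.v i).2, hk.2, inv_one]
  · simp only [torusRev, hPQ.v, Prod.snd_swap]
    rw [key fun i => (P.v i).1, hk.1, inv_one]

lemma diagMoment_smul (k : Fin (m + 2) → Circle) (x : P.Level) :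
    diagMoment (k • x).1 = diagMoment x.1 := by
  simp only [diagMoment, level_smul_apply, norm_mul, Circle.norm_coe, one_mul]

/-- If the torus element `k` changes the phase of the twist by `k₀⁻¹ kₙ⁻¹`, it commutes with the
twist up to the involution `torusRev`. -/
lemma twist_smul_of_phase {k : Fin (m + 2) → Circle} {g : Circle × Circle} {x : P.Level}
    (h1 : c (diagMoment x.1) = -1 ∨ P.twistPhase (k • x).1 * k 0 = (g.1 : ℂ) * P.twistPhase x.1)
    (h2 : c (diagMoment x.1) = -1 ∨
      P.twistPhase (k • x).1 * k (Fin.last (m + 1)) = (g.2 : ℂ) * P.twistPhase x.1)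
    (h3 : g.1 = (k (Fin.last (m + 1)))⁻¹) (h4 : g.2 = (k 0)⁻¹) (j : Fin (m + 2)) :
    P.twist c (k • x).1 j = torusRev k j * P.twist c x.1 j := by
  have e0 : P.twistFirst c (k • x).1 = ((k (Fin.last (m + 1)))⁻¹ : Circle) * P.twistFirst c x.1 := by
    rw [twistFirst, twistFirst, diagMoment_smul, level_smul_apply, level_smul_apply, map_mul,
      ← Circle.coe_inv_eq_conj, ← h3]
    rcases h1 with h | h
    · rw [h]; ring
    · linear_combination (1 / 2 * (1 + c (diagMoment x.1)) * x.1 0) * h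
  have e1 : P.twistLast c (k • x).1 = ((k 0)⁻¹ : Circle) * P.twistLast c x.1 := by
    rw [twistLast, twistLast, diagMoment_smul, level_smul_apply, level_smul_apply, map_mul,
      ← Circle.coe_inv_eq_conj, ← h4]
    rcases h2 with h | h
    · rw [h]; simp; ring
    · linear_combination (1 / 2 * (1 + conj (c (diagMoment x.1))) * x.1 (Fin.last _)) * h
  by_cases hj0 : j = 0
  · subst hj0; rw [twist_zero, twist_zero, e0, torusRev, Fin.rev_zero]
  by_cases hj1 : j = Fin.last (m + 1)
  · subst hj1; rw [twist_last, twist_last, e1, torusRev, Fin.rev_last]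
  have hj := mem_middle.2 ⟨hj0, hj1⟩
  have e2 : P.twistNormSq c (k • x).1 j.rev = P.twistNormSq c x.1 j.rev := by
    simp only [twistNormSq, e0, e1, norm_mul, Circle.norm_coe, one_mul, level_smul_apply]
  rw [twist_middle _ _ _ hj, twist_middle _ _ _ hj, e2, level_smul_apply, norm_mul,
    Circle.norm_coe, one_mul, mul_div_assoc, map_mul, ← Circle.coe_inv_eq_conj, torusRev, mul_assoc]

lemma twistPhase_smul (k : Fin (m + 2) → Circle) (x : P.Level) : P.twistPhase (k • x).1 =
    ((∏ j ∈ middle m, k j ^ ((P.v j).1 + (P.v j).2) : Circle) : ℂ) * P.twistPhase x.1 := by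
  have e : ((∏ j ∈ middle m, k j ^ ((P.v j).1 + (P.v j).2) : Circle) : ℂ)
      = ∏ j ∈ middle m, (k j : ℂ) ^ ((P.v j).1 + (P.v j).2) :=
    (map_prod Circle.coeHom _ _).trans (Finset.prod_congr rfl fun j _ => Circle.coe_zpow _ _)
  rw [e, twistPhase, twistPhase, ← Finset.prod_mul_distrib]
  refine Finset.prod_congr rfl fun j _ => ?_
  rw [level_smul_apply, norm_mul, Circle.norm_coe, one_mul, mul_div_assoc, mul_zpow]

/-- This is what the factor μ is for: on a K-orbit it varies by k₁⁻¹ kₙ⁻¹, so that μ x₁ and conj xₙ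
both scale by kₙ⁻¹, and μ xₙ and conj x₁ both scale by k₁⁻¹. -/
lemma twist_smul_of_mem {k : Fin (m + 2) → Circle} (hk : k ∈ P.K) (x : P.Level)
    (j : Fin (m + 2)) : P.twist c (k • x).1 j = torusRev k j * P.twist c x.1 j := by
  -- The product of the two equations of K: it expresses the middle factors, with exponents α_j +
  -- β_j, as k₁⁻¹ kₙ⁻¹.
  have e := P.prod_circle_of_mem_K hk 1 1
  rw [prod_split last_ne_zero.symm, P.v_first, P.v_last] at e
  simp only [one_mul, add_zero, zero_add, zpow_one] at e
  refine twist_smul_of_phase (g := ((k (Fin.last (m + 1)))⁻¹, (k 0)⁻¹)) (Or.inr ?_) (Or.inr ?_) rfl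
    rfl j
  · rw [twistPhase_smul, mul_right_comm, ← Circle.coe_mul]
    refine congrArg (fun t : Circle => (t : ℂ) * _) (eq_inv_of_mul_eq_one_left ?_)
    rw [← e, mul_assoc, mul_comm]
  · rw [twistPhase_smul, mul_right_comm, ← Circle.coe_mul]
    refine congrArg (fun t : Circle => (t : ℂ) * _) (eq_inv_of_mul_eq_one_left ?_)
    rw [← e, mul_assoc, mul_comm, mul_comm (k 0)]

/-- The anti-diagonal circle fixes μ and multiplies both x₁ and conj xₙ by λ; this fails for a
general element of the torus. -/
lemma twist_smul_ends (l : Circle) (x : P.Level) (j : Fin (m + 2)) :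
    P.twist c (ends (m := m) (l, l⁻¹) • x).1 j = (ends (l, l⁻¹) j : Circle) * P.twist c x.1 j := by
  -- Reversal exchanges λ and λ⁻¹, and inversion exchanges them back.
  have t : torusRev (ends (m := m) (l, l⁻¹)) = ends (l, l⁻¹) := by
    funext i
    simp only [torusRev, ends, Fin.rev_eq_iff, Fin.rev_last, Fin.rev_zero]
    by_cases h0 : i = 0
    · subst h0; simp [last_ne_zero.symm]
    by_cases h1 : i = Fin.last (m + 1)
    · subst h1; simp
    simp [h0, h1]
  have e0 : ends (m := m) (l, l⁻¹) 0 = l := if_pos rfl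
  have e1 : ends (m := m) (l, l⁻¹) (Fin.last (m + 1)) = l⁻¹ := by
    rw [ends, if_neg last_ne_zero, if_pos rfl]
  have e : P.twistPhase (ends (m := m) (l, l⁻¹) • x).1 = P.twistPhase x.1 := by
    rw [twistPhase_smul, Finset.prod_eq_one, Circle.coe_one, one_mul]
    intro i hi
    rw [ends, if_neg (mem_middle.1 hi).1, if_neg (mem_middle.1 hi).2, one_zpow]
  have key := twist_smul_of_phase (c := c) (g := (l, l⁻¹)) (k := ends (m := m) (l, l⁻¹)) (x := x)
    (Or.inr (by rw [e, e0, mul_comm])) (Or.inr (by rw [e, e1, mul_comm])) (by rw [e1, inv_inv])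
    (by rw [e0]) j
  rwa [t] at key

/-- The map of the reduced spaces induced by the twist. -/
def twistMap (hPQ : P.IsMirror Q) (hc : P.TwistProfile b c) : P.Model → Q.Model :=
  Quotient.map (hc.levelMap hPQ) (by
    rintro x y ⟨⟨k, hk⟩, rfl⟩
    exact ⟨⟨torusRev k, torusRev_mem hPQ hk⟩,
      Subtype.ext (funext fun j => (twist_smul_of_mem hk y j).symm)⟩)

lemma twistMap_quot (hPQ : P.IsMirror Q) (hc : P.TwistProfile b c) (x : P.Level) :
    twistMap hPQ hc (P.quot x) = Q.quot (hc.levelMap hPQ x) := rfl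

lemma twistMap_twistMap (hPQ : P.IsMirror Q) (hc : P.TwistProfile b c) (p : P.Model) :
    twistMap hPQ.symm (hc.conj hPQ) (twistMap hPQ hc p) = p := by
  obtain ⟨x, rfl⟩ := P.quot_surjective p
  rw [twistMap_quot, twistMap_quot]
  exact congrArg P.quot (Subtype.ext (twist_twist hPQ hc x))

lemma continuous_twistMap (hPQ : P.IsMirror Q) (hc : P.TwistProfile b c) :
    Continuous (twistMap hPQ hc) := by
  rw [(P.isOpenMap_quot.isQuotientMap P.continuous_quot P.quot_surjective).continuous_iff]
  refine Q.continuous_quot.comp (Continuous.subtype_mk ?_ _)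
  exact continuous_iff_continuousAt.2 fun x =>
    (hc.contDiffAt_twist x).continuousAt.comp continuous_subtype_val.continuousAt

lemma twistMap_smul (hPQ : P.IsMirror Q) (hc : P.TwistProfile b c) (l : Circle) (p : P.Model) :
    twistMap hPQ hc (((l, l⁻¹) : Circle × Circle) • p)
      = ((l, l⁻¹) : Circle × Circle) • twistMap hPQ hc p := by
  obtain ⟨x, rfl⟩ := P.quot_surjective p
  exact congrArg Q.quot (Subtype.ext (funext fun j => twist_smul_ends l x j))

/-! ### Moments, isotropy spheres and blowup maps under the induced map -/

lemma modelMoment_quot (x : P.Level) : P.modelMoment (P.quot x) =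
    ((1 / 2 : ℝ) * ‖x.1 0‖ ^ 2, (1 / 2 : ℝ) * ‖x.1 (Fin.last (m + 1))‖ ^ 2) := rfl

lemma modelMoment_add_quot (x : P.Level) :
    (P.modelMoment (P.quot x)).1 + (P.modelMoment (P.quot x)).2 = diagMoment x.1 := by
  rw [modelMoment_quot, diagMoment_eq]

lemma modelMoment_twistMap_add (hPQ : P.IsMirror Q) (hc : P.TwistProfile b c) (p : P.Model) :
    (Q.modelMoment (twistMap hPQ hc p)).1 + (Q.modelMoment (twistMap hPQ hc p)).2
      = (P.modelMoment p).1 + (P.modelMoment p).2 := by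
  obtain ⟨x, rfl⟩ := P.quot_surjective p
  rw [twistMap_quot, modelMoment_add_quot, modelMoment_add_quot]
  exact hc.diagMoment_twist x

lemma pairing_modelMoment_quot (x : P.Level) (i : Fin (m + 2)) :
    pairing (P.modelMoment (P.quot x)) (P.v i) = P.a i ↔ x.1 i = 0 := by
  have := P.half_norm_level x i
  rw [modelMoment_quot]
  constructor
  · intro h
    rw [h, sub_self] at this
    simpa using this
  · intro h
    rw [h, norm_zero] at this
    linarith

lemma pairing_twistMap_iff (hPQ : P.IsMirror Q) (hc : P.TwistProfile b c) (p : P.Model)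
    {i : Fin (m + 2)} (hi : i ∈ middle m) :
    pairing (Q.modelMoment (twistMap hPQ hc p)) (Q.v i.rev) = Q.a i.rev ↔
      pairing (P.modelMoment p) (P.v i) = P.a i := by
  obtain ⟨x, rfl⟩ := P.quot_surjective p
  rw [twistMap_quot, pairing_modelMoment_quot, pairing_modelMoment_quot]
  refine (hc.twist_eq_zero_iff x (rev_mem_middle.2 hi)).trans ?_
  rw [Fin.rev_rev]

lemma modelBlowup_quot (x : P.Level) :
    P.modelBlowup (P.quot x) = P.coords 0 (Fin.last (m + 1)) x.1 := rfl

lemma coords_zero_last (x : Fin (m + 2) → ℂ) : P.coords 0 (Fin.last (m + 1)) x =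
    (x 0 * ∏ j ∈ middle m, (x j / ‖x j‖) ^ (P.v j).1,
     x (Fin.last (m + 1)) * ∏ j ∈ middle m, (x j / ‖x j‖) ^ (P.v j).2) := by
  simp only [coords, P.v_first, P.v_last, det₂]
  simp

/-- The rotation of `ℂ²` that the twist induces under the blowup maps. -/
def rotation (c : ℝ → ℂ) (z : ℂ × ℂ) : ℂ × ℂ :=
  let s := c ((1 / 2 : ℝ) * (‖z.1‖ ^ 2 + ‖z.2‖ ^ 2))
  ((1 / 2) * ((1 + s) * z.1 + (1 - s) * conj z.2),
    (1 / 2) * ((1 - conj s) * conj z.1 + (1 + conj s) * z.2))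

/-- Let A and B be the phase products with exponents α_j and β_j, so that p = A x₁, q = conj (B xₙ)
and μ = A B. The corresponding products for the twisted point are conj B and conj A; multiplying the
outer coordinates by them turns μ x₁ into p and conj xₙ into q. -/
lemma coords_twist (hPQ : P.IsMirror Q) (hc : P.TwistProfile b c) (x : P.Level)
    (hx0 : ∀ j ∈ middle m, x.1 j ≠ 0) : Q.coords 0 (Fin.last (m + 1)) (P.twist c x.1)
      = rotation c (P.coords 0 (Fin.last (m + 1)) x.1) := by
  have ph : ∀ f : Fin (m + 2) → ℤ, ∏ j ∈ middle m,
      (P.twist c x.1 j / ‖P.twist c x.1 j‖) ^ f j.rev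
        = conj (∏ j ∈ middle m, (x.1 j / ‖x.1 j‖) ^ f j) := by
    intro f
    rw [← prod_middle_rev, map_prod]
    refine Finset.prod_congr rfl fun j hj => ?_
    have hj' := rev_mem_middle.2 hj
    have hs : 0 < Real.sqrt (P.twistNormSq c x.1 j) :=
      Real.sqrt_pos.2 (hc.twistNormSq_pos_of_ne_zero x hj (hx0 j hj))
    rw [twist_middle _ _ _ hj', Fin.rev_rev, norm_mul, Complex.norm_conj,
      ← coe_phase (hx0 _ hj), Circle.norm_coe, one_mul, Complex.norm_real,
      Real.norm_eq_abs, abs_of_pos hs, mul_div_assoc, div_self (by exact_mod_cast hs.ne'), mul_one,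
      map_zpow₀]
  have un : ∀ f : Fin (m + 2) → ℤ, ‖∏ j ∈ middle m, (x.1 j / ‖x.1 j‖) ^ f j‖ = 1 := fun f => by
    rw [coe_prod_phase hx0, Circle.norm_coe]
  have hA := un fun j => (P.v j).1
  have hB := un fun j => (P.v j).2
  have eμ : P.twistPhase x.1 = (∏ j ∈ middle m, (x.1 j / ‖x.1 j‖) ^ (P.v j).1) *
      ∏ j ∈ middle m, (x.1 j / ‖x.1 j‖) ^ (P.v j).2 := by
    rw [twistPhase, ← Finset.prod_mul_distrib]
    refine Finset.prod_congr rfl fun j hj => zpow_add₀ ?_ _ _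
    rw [← coe_phase (hx0 j hj)]
    exact Circle.coe_ne_zero _
  rw [coords_zero_last, coords_zero_last]
  simp only [hPQ.v, Prod.fst_swap, Prod.snd_swap, ph fun j => (P.v j).2, ph fun j => (P.v j).1]
  set A := ∏ j ∈ middle m, (x.1 j / ‖x.1 j‖) ^ (P.v j).1
  set B := ∏ j ∈ middle m, (x.1 j / ‖x.1 j‖) ^ (P.v j).2
  have hA' : A * conj A = 1 := by rw [Complex.mul_conj']; simp [hA]
  have hB' : B * conj B = 1 := by rw [Complex.mul_conj']; simp [hB]
  rw [twist_zero, twist_last, twistFirst, twistLast, eμ, rotation]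
  simp only [norm_mul, hA, hB, mul_one, map_mul, ← diagMoment.eq_1]
  refine Prod.ext ?_ ?_
  · simp only
    linear_combination (1 / 2 * (1 + c (diagMoment x.1)) * A * x.1 0) * hB'
  · simp only
    linear_combination (1 / 2 * (1 + conj (c (diagMoment x.1))) * B * x.1 (Fin.last _)) * hA'

lemma rotation_of_eq_one {z : ℂ × ℂ} (h : c ((1 / 2 : ℝ) * (‖z.1‖ ^ 2 + ‖z.2‖ ^ 2)) = 1) :
    rotation c z = z := by
  rw [rotation, h]
  refine Prod.ext ?_ ?_
  · simp only; ring
  · simp only [map_one]; ring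

lemma modelBlowup_twistMap (hPQ : P.IsMirror Q) (hc : P.TwistProfile b c) (p : P.Model)
    (hb : b ≤ (P.modelMoment p).1 + (P.modelMoment p).2)
    (h1 : c ((P.modelMoment p).1 + (P.modelMoment p).2) = 1) :
    Q.modelBlowup (twistMap hPQ hc p) = P.modelBlowup p := by
  obtain ⟨x, rfl⟩ := P.quot_surjective p
  rw [modelMoment_add_quot] at hb h1
  rw [twistMap_quot, modelBlowup_quot, modelBlowup_quot]
  have hx0 := hc.level_ne_zero x hb
  refine (coords_twist hPQ hc x hx0).trans (rotation_of_eq_one ?_)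
  rw [coords_zero_last]
  simp only [norm_mul]
  rw [coe_prod_phase hx0, coe_prod_phase hx0, Circle.norm_coe, Circle.norm_coe, mul_one, mul_one]
  exact h1

lemma twistMap_notMem (hPQ : P.IsMirror Q) (hc : P.TwistProfile b c) (p : P.Model)
    (hb : b ≤ (P.modelMoment p).1 + (P.modelMoment p).2) {i : Fin (m + 2)} (hi : i ∈ middle m) :
    pairing (Q.modelMoment (twistMap hPQ hc p)) (Q.v i) ≠ Q.a i := by
  rw [← Fin.rev_rev i, Ne, pairing_twistMap_iff hPQ hc p (rev_mem_middle.2 hi)]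
  obtain ⟨x, rfl⟩ := P.quot_surjective p
  rw [modelMoment_add_quot] at hb
  rw [pairing_modelMoment_quot]
  exact hc.level_ne_zero x hb _ (rev_mem_middle.2 hi)

/-! ### The reduced form in coordinates -/

/-- The standard area form on `ℂ`. -/
def area (u v : ℂ) : ℝ := u.re * v.im - u.im * v.re

/-- The standard symplectic form on `ℂ²`. -/
def planeForm (u v : ℂ × ℂ) : ℝ := area u.1 v.1 + area u.2 v.2

/-- The differential of `|z|² / 2`. -/
def radial (z u : ℂ) : ℝ := z.re * u.re + z.im * u.im

lemma stdForm_apply (n : ℕ) (u v : Fin n → ℂ) : stdForm n u v = ∑ j, area (u j) (v j) := by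
  simp [stdForm, area]

lemma area_mul (g u v : ℂ) (hg : ‖g‖ = 1) : area (g * u) (g * v) = area u v := by
  have h : g.re * g.re + g.im * g.im = 1 := by rw [← sq_norm_eq, hg]; norm_num
  simp only [area, Complex.mul_re, Complex.mul_im]
  linear_combination (u.re * v.im - u.im * v.re) * h

lemma area_add_rotate (z u v : ℂ) (s t : ℝ) :
    area (u + z * (Complex.I * s)) (v + z * (Complex.I * t))
      = area u v + (radial z u * t - radial z v * s) := by
  simp only [area, radial, Complex.add_re, Complex.add_im, Complex.mul_re, Complex.mul_im,
    Complex.I_re, Complex.I_im, Complex.ofReal_re, Complex.ofReal_im]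
  ring

/-- In polar coordinates the area form is `d(r² / 2) ∧ dθ`. -/
lemma area_polar {z : ℂ} (hz : z ≠ 0) (u v : ℂ) : area u v =
    radial z u * (area z v / ‖z‖ ^ 2) - radial z v * (area z u / ‖z‖ ^ 2) := by
  have h : ‖z‖ ^ 2 ≠ 0 := pow_ne_zero _ (norm_ne_zero_iff.2 hz)
  field_simp
  rw [sq_norm_eq]
  simp only [area, radial]
  ring

/-- The differential of `∑ c_j θ_j`, where `θ_j` is the argument of the `j`-th coordinate. -/
def angular (s : Finset (Fin (m + 2))) (e : Fin (m + 2) → ℤ) (x u : Fin (m + 2) → ℂ) : ℝ :=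
  ∑ j ∈ s, e j * (area (x j) (u j) / ‖x j‖ ^ 2)

/-! ### Derivatives of moduli and phases along curves -/

lemma hasDerivAt_half_norm_sq {γ : ℝ → ℂ} {γ' : ℂ} {t : ℝ} (h : HasDerivAt γ γ' t) :
    HasDerivAt (fun t => (1 / 2 : ℝ) * ‖γ t‖ ^ 2) (radial (γ t) γ') t := by
  have h1 : HasDerivAt (fun t => (γ t).re) γ'.re t :=
    (Complex.reCLM.hasFDerivAt (x := γ t)).comp_hasDerivAt t h
  have h2 : HasDerivAt (fun t => (γ t).im) γ'.im t :=
    (Complex.imCLM.hasFDerivAt (x := γ t)).comp_hasDerivAt t h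
  simp only [sq_norm_eq]
  refine (((h1.mul h1).add (h2.mul h2)).const_mul (1 / 2 : ℝ)).congr_deriv ?_
  simp only [radial]
  ring

/-- With z = r e^{iθ}, the velocity of e^{iθ} is e^{iθ} · i dθ, and dθ is `area` divided by r². -/
lemma hasDerivAt_phase {γ : ℝ → ℂ} {γ' : ℂ} {t : ℝ} (h : HasDerivAt γ γ' t) (h0 : γ t ≠ 0) :
    HasDerivAt (fun t => γ t / (‖γ t‖ : ℂ))
      (γ t / ‖γ t‖ * (Complex.I * (area (γ t) γ' / ‖γ t‖ ^ 2 : ℝ))) t := by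
  have hn : ‖γ t‖ ≠ 0 := norm_ne_zero_iff.2 h0
  have h1 := (hasDerivAt_half_norm_sq h).const_mul 2
  have h2 : HasDerivAt (fun t => ‖γ t‖) (radial (γ t) γ' / ‖γ t‖) t := by
    have := h1.sqrt (by positivity)
    have e : ∀ s, Real.sqrt (2 * (1 / 2 * ‖γ s‖ ^ 2)) = ‖γ s‖ := fun s => by
      rw [show 2 * (1 / 2 * ‖γ s‖ ^ 2) = ‖γ s‖ ^ 2 by ring, Real.sqrt_sq (norm_nonneg _)]
    simp only [e] at this
    refine this.congr_deriv ?_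
    field_simp
  have h3 : HasDerivAt (fun t => (‖γ t‖ : ℂ)) ((radial (γ t) γ' / ‖γ t‖ : ℝ) : ℂ) t :=
    (Complex.ofRealCLM.hasFDerivAt (x := ‖γ t‖)).comp_hasDerivAt t h2
  have hn' : (‖γ t‖ : ℂ) ≠ 0 := by exact_mod_cast hn
  refine (h.div h3 hn').congr_deriv ?_
  have hs : (‖γ t‖ : ℂ) ^ 2 = (γ t).re * (γ t).re + (γ t).im * (γ t).im := by
    exact_mod_cast sq_norm_eq (γ t)
  push_cast
  field_simp
  rw [hs]
  apply Complex.ext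
  · simp [area, radial]; ring
  · simp [area, radial]; ring

lemma hasDerivAt_zpow_of_rotate {γ : ℝ → ℂ} {t τ : ℝ}
    (h : HasDerivAt γ (γ t * (Complex.I * τ)) t) (h0 : γ t ≠ 0) (e : ℤ) :
    HasDerivAt (fun t => γ t ^ e) (γ t ^ e * (Complex.I * (e * τ : ℝ))) t := by
  refine ((hasDerivAt_zpow e (γ t) (Or.inl h0)).comp t h).congr_deriv ?_
  rw [zpow_sub_one₀ h0]
  push_cast
  field_simp

lemma hasDerivAt_prod_of_rotate {ι : Type*} (s : Finset ι) {γ : ι → ℝ → ℂ} {t : ℝ} {τ : ι → ℝ}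
    (h : ∀ j ∈ s, HasDerivAt (γ j) (γ j t * (Complex.I * τ j)) t) :
    HasDerivAt (fun t => ∏ j ∈ s, γ j t)
      ((∏ j ∈ s, γ j t) * (Complex.I * (∑ j ∈ s, τ j : ℝ))) t := by
  classical
  induction s using Finset.induction_on with
  | empty => simpa using hasDerivAt_const t (1 : ℂ)
  | insert a s ha ih =>
    simp only [Finset.prod_insert ha, Finset.sum_insert ha]
    refine ((h a (Finset.mem_insert_self _ _)).mul
      (ih fun j hj => h j (Finset.mem_insert_of_mem hj))).congr_deriv ?_
    push_cast
    ring

lemma hasDerivAt_phases {γ : ℝ → Fin (m + 2) → ℂ} {γ' : Fin (m + 2) → ℂ} {t : ℝ}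
    (h : HasDerivAt γ γ' t) {s : Finset (Fin (m + 2))} (h0 : ∀ j ∈ s, γ t j ≠ 0)
    (e : Fin (m + 2) → ℤ) :
    HasDerivAt (fun t => ∏ j ∈ s, (γ t j / (‖γ t j‖ : ℂ)) ^ e j)
      ((∏ j ∈ s, (γ t j / ‖γ t j‖) ^ e j) * (Complex.I * (angular s e (γ t) γ' : ℝ))) t := by
  refine hasDerivAt_prod_of_rotate s
    (γ := fun j t => (γ t j / (‖γ t j‖ : ℂ)) ^ e j) fun j hj => ?_
  refine hasDerivAt_zpow_of_rotate (hasDerivAt_phase (hasDerivAt_pi.1 h j) (h0 j hj)) ?_ _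
  exact div_ne_zero (h0 j hj) (by simpa using h0 j hj)

lemma isOpen_nonvanishing (i i' : Fin (m + 2)) : IsOpen (nonvanishing i i') := by
  have : nonvanishing i i' = ⋂ j, ⋂ (_ : j ≠ i), ⋂ (_ : j ≠ i'), {x | x j ≠ 0} := by
    ext x; simp [nonvanishing]
  rw [this]
  refine isOpen_iInter_of_finite fun j => isOpen_iInter_of_finite fun _ =>
    isOpen_iInter_of_finite fun _ => isOpen_ne_fun (continuous_apply j) continuous_const

lemma contDiffAt_coords {i i' : Fin (m + 2)} {x : Fin (m + 2) → ℂ} (hx : x ∈ nonvanishing i i') :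
    ContDiffAt ℝ ∞ (P.coords i i') x :=
  (P.contDiffOn_coords i i').contDiffAt ((isOpen_nonvanishing i i').mem_nhds hx)

/-- The product rule, with the unit factors pulled out: each component is a rotation of u + x · i dθ
for a combination θ of the other angles. This is the shape that `area_mul` and `area_add_rotate`
require. -/
lemma fderiv_coords {i i' : Fin (m + 2)} {x : Fin (m + 2) → ℂ} (hx : x ∈ nonvanishing i i')
    (u : Fin (m + 2) → ℂ) : fderiv ℝ (P.coords i i') x u =
      ((∏ j ∈ ({i, i'} : Finset (Fin (m + 2)))ᶜ, (x j / ‖x j‖) ^ det₂ (P.v j) (P.v i')) *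
        (u i + x i * (Complex.I * (angular {i, i'}ᶜ (fun j => det₂ (P.v j) (P.v i')) x u : ℝ))),
       (∏ j ∈ ({i, i'} : Finset (Fin (m + 2)))ᶜ, (x j / ‖x j‖) ^ det₂ (P.v i) (P.v j)) *
        (u i' + x i' * (Complex.I * (angular {i, i'}ᶜ (fun j => det₂ (P.v i) (P.v j)) x u : ℝ)))) := by
  have hγ : HasDerivAt (fun t : ℝ => x + t • u) u 0 := by
    simpa using ((hasDerivAt_id (0 : ℝ)).smul_const u).const_add x
  have hγ0 : x + (0 : ℝ) • u = x := by simp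
  have hD : HasFDerivAt (P.coords i i') (fderiv ℝ (P.coords i i') x) (x + (0 : ℝ) • u) := by
    rw [hγ0]
    exact ((contDiffAt_coords hx).differentiableAt (by simp)).hasFDerivAt
  have h1 := hD.comp_hasDerivAt (0 : ℝ) hγ
  have hx' : ∀ j ∈ ({i, i'} : Finset (Fin (m + 2)))ᶜ, (x + (0 : ℝ) • u) j ≠ 0 := fun j hj => by
    rw [hγ0]; exact hx j (mem_compl_pair.1 hj).1 (mem_compl_pair.1 hj).2
  have h2 := ((hasDerivAt_pi.1 hγ i).mul
      (hasDerivAt_phases hγ hx' fun j => det₂ (P.v j) (P.v i'))).prodMk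
    ((hasDerivAt_pi.1 hγ i').mul (hasDerivAt_phases hγ hx' fun j => det₂ (P.v i) (P.v j)))
  refine (h1.unique h2).trans ?_
  rw [hγ0]
  refine Prod.ext ?_ ?_ <;> simp only <;> ring

/-- On the tangent spaces of the level set, the standard form is the pull-back of the standard form
of `ℂ²` under `coords`. -/
lemma planeForm_fderiv_coords {i i' : Fin (m + 2)} (hdet : det₂ (P.v i) (P.v i') = 1)
    {x : Fin (m + 2) → ℂ} (hx : x ∈ nonvanishing i i') {u v : Fin (m + 2) → ℂ} {wu wv : ℝ × ℝ}
    (hu : ∀ j, radial (x j) (u j) = pairing wu (P.v j))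
    (hv : ∀ j, radial (x j) (v j) = pairing wv (P.v j)) :
    planeForm (fderiv ℝ (P.coords i i') x u) (fderiv ℝ (P.coords i i') x v)
      = stdForm (m + 2) u v := by
  have hx' : ∀ j ∈ ({i, i'} : Finset (Fin (m + 2)))ᶜ, x j ≠ 0 :=
    fun j hj => hx j (mem_compl_pair.1 hj).1 (mem_compl_pair.1 hj).2
  have hdet' : ((P.v i).1 : ℝ) * (P.v i').2 - (P.v i).2 * (P.v i').1 = 1 := by
    exact_mod_cast hdet
  rw [fderiv_coords hx, fderiv_coords hx, planeForm]
  simp only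
  rw [area_mul _ _ _ (by rw [coe_prod_phase hx', Circle.norm_coe]),
    area_mul _ _ _ (by rw [coe_prod_phase hx', Circle.norm_coe]), area_add_rotate, area_add_rotate,
    stdForm_apply, ← Finset.sum_add_sum_compl ({i, i'} : Finset (Fin (m + 2))),
    Finset.sum_pair (P.ne_of_det hdet)]
  -- In polar form each remaining area is d(r²/2) ∧ dθ. On tangent vectors of the level set the
  -- radial part is linear in v_j, and expanding v_j in the basis v_i, v_{i'} distributes it over
  -- the two angular corrections.
  have key : ∑ j ∈ ({i, i'} : Finset (Fin (m + 2)))ᶜ, area (u j) (v j) =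
      (radial (x i) (u i) * angular {i, i'}ᶜ (fun j => det₂ (P.v j) (P.v i')) x v
        - radial (x i) (v i) * angular {i, i'}ᶜ (fun j => det₂ (P.v j) (P.v i')) x u)
      + (radial (x i') (u i') * angular {i, i'}ᶜ (fun j => det₂ (P.v i) (P.v j)) x v
        - radial (x i') (v i') * angular {i, i'}ᶜ (fun j => det₂ (P.v i) (P.v j)) x u) := by
    simp only [angular, Finset.mul_sum]
    rw [← Finset.sum_sub_distrib, ← Finset.sum_sub_distrib, ← Finset.sum_add_distrib]
    refine Finset.sum_congr rfl fun j hj => ?_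
    have expand : ∀ w, pairing w (P.v j) = det₂ (P.v j) (P.v i') * pairing w (P.v i)
        + det₂ (P.v i) (P.v j) * pairing w (P.v i') := by
      intro w
      simp only [pairing, det₂]
      push_cast
      linear_combination (-w.1 * (P.v j).1 - w.2 * (P.v j).2) * hdet'
    rw [area_polar (hx' j hj), hu, hv, hu, hv, hu, hv, expand, expand]
    ring
  rw [key]
  ring

/-- A map into the level set pulls the standard form of `ℂⁿ` back to the pull-back of the standard
form of `ℂ²` under its composition with `coords`. -/
lemma planeForm_fderiv_comp {i i' : Fin (m + 2)} (hdet : det₂ (P.v i) (P.v i') = 1)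
    {f : ℂ × ℂ → Fin (m + 2) → ℂ} {z : ℂ × ℂ} (hf : DifferentiableAt ℝ f z)
    (hz : f z ∈ nonvanishing i i')
    (hlev : ∀ᶠ y in 𝓝 z, ∀ j, (1 / 2 : ℝ) * ((P.v j).1 * ‖f y 0‖ ^ 2 - ‖f y j‖ ^ 2 +
      (P.v j).2 * ‖f y (Fin.last (m + 1))‖ ^ 2) = P.a j) (u v : ℂ × ℂ) :
    planeForm (fderiv ℝ (fun y => P.coords i i' (f y)) z u)
        (fderiv ℝ (fun y => P.coords i i' (f y)) z v)
      = stdForm (m + 2) (fderiv ℝ f z u) (fderiv ℝ f z v) := by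
  have hcomp : fderiv ℝ (fun y => P.coords i i' (f y)) z
      = (fderiv ℝ (P.coords i i') (f z)).comp (fderiv ℝ f z) :=
    fderiv_comp z ((contDiffAt_coords hz).differentiableAt (by simp)) hf
  -- Differentiating the level equations along a line: the radial parts at the first and last
  -- coordinates determine all the others.
  have tangent : ∀ u : ℂ × ℂ, ∀ j, radial (f z j) (fderiv ℝ f z u j) =
      pairing (radial (f z 0) (fderiv ℝ f z u 0),
        radial (f z (Fin.last (m + 1))) (fderiv ℝ f z u (Fin.last (m + 1)))) (P.v j) := by
    intro u j
    have hl : HasDerivAt (fun t : ℝ => z + t • u) u 0 := by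
      simpa using ((hasDerivAt_id (0 : ℝ)).smul_const u).const_add z
    have hz0 : z + (0 : ℝ) • u = z := by simp
    have hγ : HasDerivAt (fun t : ℝ => f (z + t • u)) (fderiv ℝ f z u) 0 := by
      refine HasFDerivAt.comp_hasDerivAt (0 : ℝ) (l := f) ?_ hl
      rw [hz0]
      exact hf.hasFDerivAt
    have d := fun i => hasDerivAt_half_norm_sq (hasDerivAt_pi.1 hγ i)
    have D := (((d 0).const_mul ((P.v j).1 : ℝ)).sub (d j)).add
      ((d (Fin.last (m + 1))).const_mul ((P.v j).2 : ℝ))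
    have hev : ∀ᶠ t : ℝ in 𝓝 0, (P.v j).1 * ((1 / 2 : ℝ) * ‖f (z + t • u) 0‖ ^ 2)
        - (1 / 2 : ℝ) * ‖f (z + t • u) j‖ ^ 2
        + (P.v j).2 * ((1 / 2 : ℝ) * ‖f (z + t • u) (Fin.last (m + 1))‖ ^ 2) = P.a j := by
      have hc := hl.continuousAt.tendsto
      rw [hz0] at hc
      filter_upwards [hc.eventually hlev] with t ht
      linear_combination ht j
    have D' := (hasDerivAt_const (0 : ℝ) (P.a j)).congr_of_eventuallyEq hev
    have e := D.unique D'
    rw [hz0] at e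
    simp only [pairing]
    linear_combination -e
  rw [hcomp]
  exact planeForm_fderiv_coords hdet hz (tangent u) (tangent v)

/-! ### The volume form -/

/-- The standard volume form on `ℂ²`. -/
def planeVol (u₁ u₂ u₃ u₄ : ℂ × ℂ) : ℝ :=
  planeForm u₁ u₂ * planeForm u₃ u₄ - planeForm u₁ u₃ * planeForm u₂ u₄
    + planeForm u₁ u₄ * planeForm u₂ u₃

/-- A shear in the second factor along the angular direction preserves the volume. -/
lemma planeVol_shear (p q : ℂ) (k : ℝ) (w₁ w₂ w₃ w₄ : ℂ × ℂ) (A : ℂ × ℂ → ℂ × ℂ)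
    (hA : ∀ w w', planeForm (A w) (A w') = planeForm w w' +
      k * (radial q w.2 * radial p w'.1 - radial q w'.2 * radial p w.1)) :
    planeVol (A w₁) (A w₂) (A w₃) (A w₄) = planeVol w₁ w₂ w₃ w₄ := by
  -- The added form σ is k times the wedge of a radial 1-form of each factor. Hence σ ∧ σ = 0, and
  -- its wedge with either area form vanishes because it contains a 3-form on a plane.
  simp only [planeVol, hA]
  simp only [planeForm, area, radial]
  ring

/-- The real linear isomorphism `(p, q) ↦ ((p + q) / 2, conj ((p - q) / 2))`. -/
def halfSum (w : ℂ × ℂ) : ℂ × ℂ := ((1 / 2) * (w.1 + w.2), (1 / 2) * conj (w.1 - w.2))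

/-- The symplectic form is not rescaled by this map, only its square. The constant is harmless,
since the change of coordinates is applied and then undone. -/
lemma planeVol_halfSum (w₁ w₂ w₃ w₄ : ℂ × ℂ) :
    planeVol (halfSum w₁) (halfSum w₂) (halfSum w₃) (halfSum w₄)
      = -(1 / 4) * planeVol w₁ w₂ w₃ w₄ := by
  have h : ∀ w w', planeForm (halfSum w) (halfSum w')
      = (1 / 2) * (area w.1 w'.2 + area w.2 w'.1) := by
    intro w w'
    simp [planeForm, halfSum, area]
    ring
  simp only [planeVol, h]
  simp only [planeForm, area]
  ring

/-- The derivative of a smooth function to the unit circle is tangential. -/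
lemma exists_deriv_eq_of_norm_eq_one (hc : Differentiable ℝ c) (h1 : ∀ s, ‖c s‖ = 1) (s : ℝ) :
    ∃ κ : ℝ, deriv c s = c s * (Complex.I * κ) := by
  have h := hasDerivAt_half_norm_sq (hc s).hasDerivAt
  simp only [h1] at h
  have h0 : radial (c s) (deriv c s) = 0 := h.unique (hasDerivAt_const s _)
  have hn : (c s).re * (c s).re + (c s).im * (c s).im = 1 := by rw [← sq_norm_eq, h1]; norm_num
  refine ⟨area (c s) (deriv c s), ?_⟩
  simp only [radial] at h0
  apply Complex.ext
  · simp [area]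
    linear_combination (-(deriv c s).re) * hn + (c s).re * h0
  · simp [area]
    linear_combination (-(deriv c s).im) * hn + (c s).im * h0

lemma contDiff_rotation (hc : ContDiff ℝ ∞ c) : ContDiff ℝ ∞ (rotation c) := by
  have h1 : ContDiff ℝ ∞ (fun z : ℂ × ℂ => z.1) := contDiff_fst
  have h2 : ContDiff ℝ ∞ (fun z : ℂ × ℂ => z.2) := contDiff_snd
  have hs : ContDiff ℝ ∞ (fun z : ℂ × ℂ => c ((1 / 2 : ℝ) * (‖z.1‖ ^ 2 + ‖z.2‖ ^ 2))) :=
    hc.comp (contDiff_const.mul ((h1.norm_sq ℝ).add (h2.norm_sq ℝ)))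
  have cj : ∀ {f : ℂ × ℂ → ℂ}, ContDiff ℝ ∞ f → ContDiff ℝ ∞ fun z => conj (f z) :=
    fun hf => Complex.conjCLE.contDiff.comp hf
  exact (contDiff_const.mul (((contDiff_const.add hs).mul h1).add
      ((contDiff_const.sub hs).mul (cj h2)))).prodMk
    (contDiff_const.mul (((contDiff_const.sub (cj hs)).mul (cj h1)).add
      ((contDiff_const.add (cj hs)).mul h2)))

lemma _root_.HasDerivAt.conj_complex {f : ℝ → ℂ} {f' : ℂ} {t : ℝ} (hf : HasDerivAt f f' t) :
    HasDerivAt (fun t => conj (f t)) (conj f') t :=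
  (Complex.conjCLE.toContinuousLinearMap.hasFDerivAt (x := f t)).comp_hasDerivAt t hf

/-- The rotation that the twist induces preserves the volume. -/
lemma planeVol_fderiv_rotation (hc : ContDiff ℝ ∞ c) (h1 : ∀ s, ‖c s‖ = 1) (z : ℂ × ℂ)
    (u₁ u₂ u₃ u₄ : ℂ × ℂ) :
    planeVol (fderiv ℝ (rotation c) z u₁) (fderiv ℝ (rotation c) z u₂)
      (fderiv ℝ (rotation c) z u₃) (fderiv ℝ (rotation c) z u₄) = planeVol u₁ u₂ u₃ u₄ := by
  obtain ⟨κ, hκ⟩ := exists_deriv_eq_of_norm_eq_one (hc.differentiable (by simp)) h1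
    ((1 / 2 : ℝ) * (‖z.1‖ ^ 2 + ‖z.2‖ ^ 2))
  have hn := h1 ((1 / 2 : ℝ) * (‖z.1‖ ^ 2 + ‖z.2‖ ^ 2))
  set s := c ((1 / 2 : ℝ) * (‖z.1‖ ^ 2 + ‖z.2‖ ^ 2)) with hs
  -- The product rule with c' = c · iκ, arranged by the eigenvectors p + q and p - q of the swap;
  -- only the second is multiplied by c.
  have deriv_eq : ∀ u : ℂ × ℂ, fderiv ℝ (rotation c) z u =
      ((1 / 2) * ((u.1 + conj u.2) + s * ((u.1 - conj u.2)
          + (z.1 - conj z.2) * (Complex.I * (κ * (radial z.1 u.1 + radial z.2 u.2) : ℝ)))),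
       (1 / 2) * conj ((u.1 + conj u.2) - s * ((u.1 - conj u.2)
          + (z.1 - conj z.2) * (Complex.I * (κ * (radial z.1 u.1 + radial z.2 u.2) : ℝ))))) := by
    intro u
    have hl : HasDerivAt (fun t : ℝ => z + t • u) u 0 := by
      simpa using ((hasDerivAt_id (0 : ℝ)).smul_const u).const_add z
    have hz0 : z + (0 : ℝ) • u = z := by simp
    have hF : HasFDerivAt (rotation c) (fderiv ℝ (rotation c) z) (z + (0 : ℝ) • u) := by
      rw [hz0]
      exact ((contDiff_rotation hc).differentiable (by simp) z).hasFDerivAt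
    have e := hF.comp_hasDerivAt (0 : ℝ) hl
    have d1 : HasDerivAt (fun t : ℝ => (z + t • u).1) u.1 0 :=
      (ContinuousLinearMap.fst ℝ ℂ ℂ).hasFDerivAt.comp_hasDerivAt (0 : ℝ) hl
    have d2 : HasDerivAt (fun t : ℝ => (z + t • u).2) u.2 0 :=
      (ContinuousLinearMap.snd ℝ ℂ ℂ).hasFDerivAt.comp_hasDerivAt (0 : ℝ) hl
    have dm : HasDerivAt (fun t : ℝ => (1 / 2 : ℝ) * (‖(z + t • u).1‖ ^ 2 + ‖(z + t • u).2‖ ^ 2))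
        (radial z.1 u.1 + radial z.2 u.2) 0 := by
      have := (hasDerivAt_half_norm_sq d1).add (hasDerivAt_half_norm_sq d2)
      rw [hz0] at this
      refine this.congr_of_eventuallyEq (Filter.Eventually.of_forall fun t => ?_)
      simp only [Pi.add_apply]
      ring
    have ds : HasDerivAt
        (fun t : ℝ => c ((1 / 2 : ℝ) * (‖(z + t • u).1‖ ^ 2 + ‖(z + t • u).2‖ ^ 2)))
        ((radial z.1 u.1 + radial z.2 u.2) • (s * (Complex.I * κ))) 0 := by
      rw [← hκ]
      refine HasDerivAt.scomp (0 : ℝ) (g₁ := c) ?_ dm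
      simp only [hz0]
      exact (hc.differentiable (by simp) _).hasDerivAt
    have dr := ((((ds.const_add 1).mul d1).add ((ds.const_sub 1).mul d2.conj_complex)).const_mul
        ((1 / 2 : ℂ))).prodMk
      ((((ds.conj_complex.const_sub 1).mul d1.conj_complex).add
        ((ds.conj_complex.const_add 1).mul d2)).const_mul ((1 / 2 : ℂ)))
    refine (e.unique dr).trans ?_
    rw [hz0, ← hs]
    refine Prod.ext ?_ ?_
    · simp only [Complex.real_smul]
      push_cast
      ring
    · simp only [Complex.real_smul, map_mul, map_add, map_sub, Complex.conj_conj,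
        Complex.conj_ofReal, Complex.conj_I]
      push_cast
      ring
  -- `T` passes to w = (p + q, p - q), where the rotation is (w₁, w₂) ↦ (w₁, c w₂) and `A` is its
  -- differential. Here s = (|w₁|² + |w₂|²) / 4, which accounts for the factor 1/2 before the radial
  -- terms.
  let T : ℂ × ℂ → ℂ × ℂ := fun u => (u.1 + conj u.2, u.1 - conj u.2)
  let A : ℂ × ℂ → ℂ × ℂ := fun w => (w.1, s * (w.2 + (z.1 - conj z.2) * (Complex.I *
    (κ * ((1 / 2) * (radial (z.1 + conj z.2) w.1 + radial (z.1 - conj z.2) w.2)) : ℝ))))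
  have hT : ∀ u, halfSum (T u) = u := fun u => by
    refine Prod.ext ?_ ?_
    · simp only [halfSum, T]; ring
    · simp only [halfSum, T, map_add, map_sub, Complex.conj_conj]; ring
  have hF : ∀ u, fderiv ℝ (rotation c) z u = halfSum (A (T u)) := fun u => by
    rw [deriv_eq]
    have : (1 / 2) * (radial (z.1 + conj z.2) (u.1 + conj u.2)
        + radial (z.1 - conj z.2) (u.1 - conj u.2)) = radial z.1 u.1 + radial z.2 u.2 := by
      simp [radial]
      ring
    simp only [halfSum, A, T, this]
  have hA : ∀ w w', planeForm (A w) (A w') = planeForm w w' + (κ / 2) *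
      (radial (z.1 - conj z.2) w.2 * radial (z.1 + conj z.2) w'.1
        - radial (z.1 - conj z.2) w'.2 * radial (z.1 + conj z.2) w.1) := fun w w' => by
    simp only [A, planeForm]
    rw [area_mul _ _ _ hn, area_add_rotate]
    ring
  simp only [hF]
  rw [planeVol_halfSum, planeVol_shear _ _ _ _ _ _ _ A hA, ← planeVol_halfSum, hT, hT, hT, hT]

/-! ### The twist in the charts -/

/-- The index of the preferred chart at `p`. -/
def chartIndex (p : P.Model) : Fin (m + 1) := Classical.choose (P.exists_vertexSource p)

lemma mem_chartIndex (p : P.Model) : p ∈ P.vertexSource (chartIndex p) :=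
  Classical.choose_spec (P.exists_vertexSource p)

lemma extChartAt_mem_target (p : P.Model) :
    extChartAt 𝓘(ℝ, ℂ × ℂ) p p ∈ P.vertexTarget (chartIndex p) :=
  (P.vertexChart (chartIndex p)).map_source (mem_chartIndex p)

lemma quot_vertexSection (p : P.Model) :
    P.quot ⟨_, P.vertexSection_mem (extChartAt_mem_target p)⟩ = p :=
  (P.vertexInv_of_mem (extChartAt_mem_target p)).symm.trans ((P.vertexChart (chartIndex p)).left_inv (mem_chartIndex p))

lemma contDiffAt_vertexSection {k : Fin (m + 1)} {z : ℂ × ℂ} (hz : z ∈ P.vertexTarget k) :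
    ContDiffAt ℝ ∞ (P.vertexSection k) z :=
  (P.contDiffOn_vertexSection k).contDiffAt ((P.isOpen_vertexTarget k).mem_nhds hz)

/-- The section takes values in the level set and is a right inverse of `coords`, which is
symplectic along the level set. -/
lemma stdForm_fderiv_vertexSection {k : Fin (m + 1)} {z : ℂ × ℂ} (hz : z ∈ P.vertexTarget k)
    (u v : ℂ × ℂ) : stdForm (m + 2) (fderiv ℝ (P.vertexSection k) z u)
      (fderiv ℝ (P.vertexSection k) z v) = planeForm u v := by
  have hev := (P.isOpen_vertexTarget k).mem_nhds hz
  have hid : (fun y => P.coords k.castSucc k.succ (P.vertexSection k y)) =ᶠ[𝓝 z] id := by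
    filter_upwards [hev] with y hy using P.coords_vertexSection hy
  rw [← planeForm_fderiv_comp (P.delzant k)
    ((contDiffAt_vertexSection hz).differentiableAt (by simp)) (P.vertexSection_ne_zero hz)
    (by filter_upwards [hev] with y hy using P.vertexSection_mem hy), hid.fderiv_eq, fderiv_id]
  rfl

/-- In the preferred charts the reduced form is the standard form. -/
lemma modelForm_apply (p : P.Model) (u v : TangentSpace 𝓘(ℝ, ℂ × ℂ) p) :
    P.modelForm p u v = planeForm u v :=
  stdForm_fderiv_vertexSection (extChartAt_mem_target p) u v

/-- The twist, read in charts at two vertices. -/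
def chartTwist (P Q : CornerPolyhedron m) (c : ℝ → ℂ) (k l : Fin (m + 1)) (z : ℂ × ℂ) : ℂ × ℂ :=
  Q.coords l.castSucc l.succ (P.twist c (P.vertexSection k z))

lemma writtenInExtChartAt_twistMap (hPQ : P.IsMirror Q) (hc : P.TwistProfile b c) (p : P.Model) :
    writtenInExtChartAt 𝓘(ℝ, ℂ × ℂ) 𝓘(ℝ, ℂ × ℂ) p (twistMap hPQ hc)
      =ᶠ[𝓝 (extChartAt 𝓘(ℝ, ℂ × ℂ) p p)]
      chartTwist P Q c (chartIndex p) (chartIndex (twistMap hPQ hc p)) := by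
  filter_upwards [(P.isOpen_vertexTarget _).mem_nhds (extChartAt_mem_target p)] with y hy
  change Q.modelCoords _ _ (Q.delzant _) (twistMap hPQ hc (P.vertexInv (chartIndex p) y)) = _
  rw [P.vertexInv_of_mem hy]
  rfl

lemma twist_mem_nonvanishing (hPQ : P.IsMirror Q) (hc : P.TwistProfile b c) (p : P.Model) :
    P.twist c (P.vertexSection (chartIndex p) (extChartAt 𝓘(ℝ, ℂ × ℂ) p p)) ∈
      nonvanishing (chartIndex (twistMap hPQ hc p)).castSucc
        (chartIndex (twistMap hPQ hc p)).succ := by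
  have h := mem_chartIndex (twistMap hPQ hc p)
  have e := congrArg (twistMap hPQ hc) (quot_vertexSection p)
  rw [twistMap_quot] at e
  -- The index depends on the image point, so it is fixed before that point is rewritten as a class
  -- `Q.quot _`.
  generalize chartIndex (twistMap hPQ hc p) = l at h ⊢
  rw [← e] at h
  exact Q.quot_mem_vertexSource.1 h

lemma contDiffAt_twist_section (hc : P.TwistProfile b c) {k : Fin (m + 1)} {z : ℂ × ℂ}
    (hz : z ∈ P.vertexTarget k) : ContDiffAt ℝ ∞ (fun y => P.twist c (P.vertexSection k y)) z :=
  ContDiffAt.comp z (g := P.twist c) (hc.contDiffAt_twist ⟨_, P.vertexSection_mem hz⟩)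
    (contDiffAt_vertexSection hz)

lemma contMDiff_twistMap (hPQ : P.IsMirror Q) (hc : P.TwistProfile b c) :
    ContMDiff 𝓘(ℝ, ℂ × ℂ) 𝓘(ℝ, ℂ × ℂ) ∞ (twistMap hPQ hc) := by
  intro p
  rw [contMDiffAt_iff]
  refine ⟨(continuous_twistMap hPQ hc).continuousAt, ContDiffAt.contDiffWithinAt ?_⟩
  refine ContDiffAt.congr_of_eventuallyEq ?_ (writtenInExtChartAt_twistMap hPQ hc p)
  exact ContDiffAt.comp (extChartAt 𝓘(ℝ, ℂ × ℂ) p p)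
    (f := fun y => P.twist c (P.vertexSection (chartIndex p) y))
    (contDiffAt_coords (twist_mem_nonvanishing hPQ hc p))
    (contDiffAt_twist_section hc (extChartAt_mem_target p))

lemma mfderiv_twistMap (hPQ : P.IsMirror Q) (hc : P.TwistProfile b c) (p : P.Model)
    (u : TangentSpace 𝓘(ℝ, ℂ × ℂ) p) :
    (mfderiv 𝓘(ℝ, ℂ × ℂ) 𝓘(ℝ, ℂ × ℂ) (twistMap hPQ hc) p u : ℂ × ℂ)
      = fderiv ℝ (chartTwist P Q c (chartIndex p) (chartIndex (twistMap hPQ hc p)))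
        (extChartAt 𝓘(ℝ, ℂ × ℂ) p p) u := by
  rw [((contMDiff_twistMap hPQ hc).mdifferentiableAt (by simp)).mfderiv]
  simp only [modelWithCornersSelf_coe, Set.range_id, fderivWithin_univ]
  rw [(writtenInExtChartAt_twistMap hPQ hc p).fderiv_eq]
  rfl

/-- The conjugate reversal is anti-symplectic. -/
lemma stdForm_conj_rev (u v : Fin (m + 2) → ℂ) :
    stdForm (m + 2) (fun j => conj (u j.rev)) (fun j => conj (v j.rev)) = -stdForm (m + 2) u v := by
  rw [stdForm_apply, stdForm_apply, ← Finset.sum_neg_distrib]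
  refine Fintype.sum_equiv Fin.revPerm _ _ fun j => ?_
  simp [area]
  ring

/-- For s < b the twist is anti-symplectic. For s ≥ b no middle coordinate vanishes, so the blowup
coordinates serve as symplectic coordinates on both sides, and in them the twist is `rotation`. -/
lemma planeVol_fderiv_chartTwist (hPQ : P.IsMirror Q) (hc : P.TwistProfile b c)
    {k l : Fin (m + 1)} {z : ℂ × ℂ} (hz : z ∈ P.vertexTarget k)
    (hl : P.twist c (P.vertexSection k z) ∈ nonvanishing l.castSucc l.succ)
    (u₁ u₂ u₃ u₄ : ℂ × ℂ) :
    planeVol (fderiv ℝ (chartTwist P Q c k l) z u₁) (fderiv ℝ (chartTwist P Q c k l) z u₂)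
      (fderiv ℝ (chartTwist P Q c k l) z u₃) (fderiv ℝ (chartTwist P Q c k l) z u₄)
      = planeVol u₁ u₂ u₃ u₄ := by
  set f : ℂ × ℂ → Fin (m + 2) → ℂ := fun y => P.twist c (P.vertexSection k y) with hf
  have hev := (P.isOpen_vertexTarget k).mem_nhds hz
  have hfd : DifferentiableAt ℝ f z := (contDiffAt_twist_section hc hz).differentiableAt (by simp)
  have hlev : ∀ᶠ y in 𝓝 z, ∀ j, (1 / 2 : ℝ) * ((Q.v j).1 * ‖f y 0‖ ^ 2 - ‖f y j‖ ^ 2 +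
      (Q.v j).2 * ‖f y (Fin.last (m + 1))‖ ^ 2) = Q.a j := by
    filter_upwards [hev] with y hy using hc.twist_mem hPQ ⟨_, P.vertexSection_mem hy⟩
  have hG : ∀ u v, planeForm (fderiv ℝ (chartTwist P Q c k l) z u)
      (fderiv ℝ (chartTwist P Q c k l) z v)
        = stdForm (m + 2) (fderiv ℝ f z u) (fderiv ℝ f z v) :=
    planeForm_fderiv_comp (Q.delzant l) hfd hl hlev
  have hsd := (contDiffAt_vertexSection hz).differentiableAt (by simp)
  let x : P.Level := ⟨_, P.vertexSection_mem hz⟩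
  have hcont : ContinuousAt (fun y => diagMoment (P.vertexSection k y)) z :=
    contDiff_diagMoment.continuous.continuousAt.comp hsd.continuousAt
  rcases lt_or_ge (diagMoment x.1) b with h | h
  · have hff : f =ᶠ[𝓝 z] fun y j => conj (P.vertexSection k y j.rev) := by
      filter_upwards [hcont.eventually_lt_const h] with y hy
      exact funext (twist_of_eq_neg_one (hc.eq_neg_one _ hy))
    have hd : ∀ u, fderiv ℝ f z u = fun j => conj (fderiv ℝ (P.vertexSection k) z u j.rev) := by
      intro u
      rw [hff.fderiv_eq]
      have : HasFDerivAt (fun y (j : Fin (m + 2)) => conj (P.vertexSection k y j.rev))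
          (ContinuousLinearMap.pi fun j : Fin (m + 2) =>
            (Complex.conjCLE.toContinuousLinearMap.comp (ContinuousLinearMap.proj j.rev)).comp
              (fderiv ℝ (P.vertexSection k) z)) z :=
        hasFDerivAt_pi.2 fun j =>
          (Complex.conjCLE.toContinuousLinearMap.comp
            (ContinuousLinearMap.proj (R := ℝ) (φ := fun _ : Fin (m + 2) => ℂ)
              j.rev)).hasFDerivAt.comp z hsd.hasFDerivAt
      rw [this.fderiv]
      rfl
    have hG' : ∀ u v, planeForm (fderiv ℝ (chartTwist P Q c k l) z u)
        (fderiv ℝ (chartTwist P Q c k l) z v) = -planeForm u v := fun u v => by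
      rw [hG, hd, hd, stdForm_conj_rev, stdForm_fderiv_vertexSection hz]
    -- The volume is quadratic in the form, so the sign disappears.
    simp only [planeVol, hG']
    ring
  · have hx0 := hc.level_ne_zero x h
    have hfx : f z ∈ nonvanishing 0 (Fin.last (m + 1)) := fun j h0 h1 => by
      have hj := mem_middle.2 ⟨h0, h1⟩
      exact fun h => hx0 _ (rev_mem_middle.2 hj) ((hc.twist_eq_zero_iff x hj).1 h)
    have hx1 : P.vertexSection k z ∈ nonvanishing 0 (Fin.last (m + 1)) :=
      fun j h0 h1 => hx0 j (mem_middle.2 ⟨h0, h1⟩)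
    have hdetP : det₂ (P.v 0) (P.v (Fin.last (m + 1))) = 1 := by simp [P.v_first, P.v_last, det₂]
    have hdetQ : det₂ (Q.v 0) (Q.v (Fin.last (m + 1))) = 1 := by simp [Q.v_first, Q.v_last, det₂]
    -- The blowup map read in the vertex chart; it is symplectic here because the outer normals (1,
    -- 0), (0, 1) also have determinant 1.
    set B : ℂ × ℂ → ℂ × ℂ := fun y => P.coords 0 (Fin.last (m + 1)) (P.vertexSection k y) with hB
    have hBform : ∀ u v, planeForm (fderiv ℝ B z u) (fderiv ℝ B z v) = planeForm u v := fun u v =>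
      (planeForm_fderiv_comp hdetP hsd hx1 (by
        filter_upwards [hev] with y hy using P.vertexSection_mem hy) u v).trans
        (stdForm_fderiv_vertexSection hz u v)
    have hBd : DifferentiableAt ℝ B z :=
      ((contDiffAt_coords hx1).differentiableAt (by simp)).comp z hsd
    have hfB : (fun y => Q.coords 0 (Fin.last (m + 1)) (f y)) =ᶠ[𝓝 z] rotation c ∘ B := by
      filter_upwards [hev, hsd.continuousAt.preimage_mem_nhds
        ((isOpen_nonvanishing _ _).mem_nhds hx1)] with y hy hy'
      exact coords_twist hPQ hc ⟨_, P.vertexSection_mem hy⟩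
        fun j hj => hy' j (mem_middle.1 hj).1 (mem_middle.1 hj).2
    have hcomp : fderiv ℝ (fun y => Q.coords 0 (Fin.last (m + 1)) (f y)) z
        = (fderiv ℝ (rotation c) (B z)).comp (fderiv ℝ B z) :=
      hfB.fderiv_eq.trans
        (fderiv_comp z ((contDiff_rotation hc.smooth).differentiable (by simp) _) hBd)
    have hG' : ∀ u v, planeForm (fderiv ℝ (chartTwist P Q c k l) z u)
        (fderiv ℝ (chartTwist P Q c k l) z v)
          = planeForm (fderiv ℝ (rotation c) (B z) (fderiv ℝ B z u))
            (fderiv ℝ (rotation c) (B z) (fderiv ℝ B z v)) := fun u v => by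
      rw [hG, ← planeForm_fderiv_comp hdetQ hfd hfx hlev, hcomp]
      rfl
    have hrot := planeVol_fderiv_rotation hc.smooth hc.norm_eq (B z) (fderiv ℝ B z u₁)
      (fderiv ℝ B z u₂) (fderiv ℝ B z u₃) (fderiv ℝ B z u₄)
    simp only [planeVol, hG', hBform] at hrot ⊢
    exact hrot

/-! ### The mirror diffeomorphism of the reduced spaces -/

/-- The diffeomorphism of the reduced spaces induced by the twist. -/
def twistDiffeo (hPQ : P.IsMirror Q) (hc : P.TwistProfile b c) :
    P.Model ≃ₘ⟮𝓘(ℝ, ℂ × ℂ), 𝓘(ℝ, ℂ × ℂ)⟯ Q.Model where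
  toFun := twistMap hPQ hc
  invFun := twistMap hPQ.symm (hc.conj hPQ)
  left_inv := twistMap_twistMap hPQ hc
  right_inv q := by
    obtain ⟨y, rfl⟩ := Q.quot_surjective q
    have h := twist_twist hPQ.symm (hc.conj hPQ) y
    simp only [Complex.conj_conj] at h
    exact congrArg Q.quot (Subtype.ext h)
  contMDiff_toFun := contMDiff_twistMap hPQ hc
  contMDiff_invFun := contMDiff_twistMap hPQ.symm (hc.conj hPQ)

lemma liouville_mfderiv_twistMap (hPQ : P.IsMirror Q) (hc : P.TwistProfile b c) (p : P.Model)
    (u₁ u₂ u₃ u₄ : TangentSpace 𝓘(ℝ, ℂ × ℂ) p) :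
    Q.modelForm.liouville (twistMap hPQ hc p)
      (mfderiv 𝓘(ℝ, ℂ × ℂ) 𝓘(ℝ, ℂ × ℂ) (twistMap hPQ hc) p u₁)
      (mfderiv 𝓘(ℝ, ℂ × ℂ) 𝓘(ℝ, ℂ × ℂ) (twistMap hPQ hc) p u₂)
      (mfderiv 𝓘(ℝ, ℂ × ℂ) 𝓘(ℝ, ℂ × ℂ) (twistMap hPQ hc) p u₃)
      (mfderiv 𝓘(ℝ, ℂ × ℂ) 𝓘(ℝ, ℂ × ℂ) (twistMap hPQ hc) p u₄)
      = P.modelForm.liouville p u₁ u₂ u₃ u₄ := by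
  have h := planeVol_fderiv_chartTwist hPQ hc (extChartAt_mem_target p)
    (twist_mem_nonvanishing hPQ hc p) u₁ u₂ u₃ u₄
  simp only [planeVol] at h
  simp only [BilinField.liouville, modelForm_apply]
  rw [mfderiv_twistMap, mfderiv_twistMap, mfderiv_twistMap, mfderiv_twistMap]
  exact h

/-! ### Existence of twist profiles -/

/-- A smooth path in the unit circle from `-1` to `1`. -/
def circlePath (b β s : ℝ) : ℂ :=
  Complex.exp ((Real.pi * (1 - Real.smoothTransition ((s - b) / (β - b))) : ℝ) * Complex.I)

lemma contDiff_circlePath (b β : ℝ) : ContDiff ℝ ∞ (circlePath b β) := by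
  have h : ContDiff ℝ ∞ fun s : ℝ =>
      Real.pi * (1 - Real.smoothTransition ((s - b) / (β - b))) := by
    refine contDiff_const.mul (contDiff_const.sub (Real.smoothTransition.contDiff.comp ?_))
    exact (contDiff_id.sub contDiff_const).div_const _
  exact ((Complex.ofRealCLM.contDiff.comp h).mul contDiff_const).cexp

lemma circlePath_of_lt {b β s : ℝ} (hb : b < β) (hs : s < b) : circlePath b β s = -1 := by
  rw [circlePath, Real.smoothTransition.zero_of_nonpos
    (div_nonpos_of_nonpos_of_nonneg (by linarith) (by linarith)), sub_zero, mul_one,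
    Complex.exp_pi_mul_I]

lemma circlePath_of_le {b β s : ℝ} (hb : b < β) (hs : β ≤ s) : circlePath b β s = 1 := by
  rw [circlePath, Real.smoothTransition.one_of_one_le
    ((one_le_div (by linarith)).2 (by linarith)), sub_self, mul_zero]
  simp

variable (P) in
/-- The union of the middle edges of `Δ`. -/
def middleEdges : Set (ℝ × ℝ) := {w | w ∈ P.toSet ∧ ∃ j ∈ middle m, pairing w (P.v j) = P.a j}

lemma continuous_pairing (v : ℤ × ℤ) : Continuous fun w => pairing w v := by
  unfold pairing
  fun_prop

lemma isClosed_middleEdges : IsClosed P.middleEdges := by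
  have e : P.middleEdges = (⋂ i, {w | P.a i ≤ pairing w (P.v i)}) ∩
      ⋃ j ∈ middle m, {w | pairing w (P.v j) = P.a j} := by
    ext w; simp [middleEdges, toSet]
  rw [e]
  refine (isClosed_iInter fun i => isClosed_le continuous_const (continuous_pairing _)).inter ?_
  exact (middle m).finite_toSet.isClosed_biUnion fun j _ =>
    isClosed_eq (continuous_pairing _) continuous_const

lemma nonneg_of_mem_toSet {w : ℝ × ℝ} (hw : w ∈ P.toSet) : 0 ≤ w.1 ∧ 0 ≤ w.2 := by
  have h0 := hw 0
  have h1 := hw (Fin.last (m + 1))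
  simp only [P.v_first, P.a_first, P.v_last, P.a_last, pairing] at h0 h1
  constructor
  · simpa using h0
  · simpa using h1

/-- The middle edges form a closed subset of a bounded square, so the coordinate sum attains its
maximum there, below β. The gap between b and β is where the path from -1 to 1 runs. -/
lemma exists_bound_of_middleEdges {β : ℝ} (h : ∀ w ∈ P.middleEdges, w.1 + w.2 < β) :
    ∃ b < β, ∀ w ∈ P.middleEdges, w.1 + w.2 < b := by
  rcases P.middleEdges.eq_empty_or_nonempty with h0 | h0
  · exact ⟨β - 1, by linarith, by simp [h0]⟩
  have hcpt : IsCompact P.middleEdges := by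
    refine (isCompact_Icc (a := ((0, 0) : ℝ × ℝ)) (b := (β, β))).of_isClosed_subset
      isClosed_middleEdges fun w hw => ?_
    obtain ⟨h1, h2⟩ := nonneg_of_mem_toSet hw.1
    have := h w hw
    exact ⟨⟨h1, h2⟩, by simp only; linarith, by simp only; linarith⟩
  obtain ⟨w, hw, hmax⟩ := hcpt.exists_isMaxOn h0
    (f := fun w => w.1 + w.2) (by fun_prop)
  -- The midpoint between the maximum and β keeps both inequalities strict.
  refine ⟨(w.1 + w.2 + β) / 2, by linarith [h w hw], fun w' hw' => ?_⟩
  have : w'.1 + w'.2 ≤ w.1 + w.2 := hmax hw'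
  linarith [h w hw]

/-- A normal strictly between (1, 0) and (0, 1) has positive coordinates, so moving in the direction
(1, 1) leads into every middle half plane. -/
lemma add_pos_of_mem_middle {j : Fin (m + 2)} (hj : j ∈ middle m) :
    0 < ((P.v j).1 + (P.v j).2 : ℝ) := by
  obtain ⟨h0, h1⟩ := mem_middle.1 hj
  have d1 := P.counterclockwise 0 j (Fin.pos_iff_ne_zero.2 h0)
  have d2 := P.counterclockwise j (Fin.last (m + 1)) (Fin.lt_last_iff_ne_last.2 h1)
  simp only [det₂, P.v_first, P.v_last] at d1 d2
  have : 0 < (P.v j).1 + (P.v j).2 := by linarith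
  exact_mod_cast this

/-- A point of the quadrant beyond all middle edges is in the interior of the half planes that they
bound. -/
lemma lt_pairing_of_bound (hE : ∀ w ∈ P.middleEdges, w.1 + w.2 < b) {w : ℝ × ℝ} (h1 : 0 ≤ w.1)
    (h2 : 0 ≤ w.2) (hb : b ≤ w.1 + w.2) {j : Fin (m + 2)} (hj : j ∈ middle m) :
    P.a j < pairing w (P.v j) := by
  by_contra! hcon
  -- Suppose the j-th inequality is not strict, and move w along (1, 1) for the least time t at
  -- which all middle inequalities hold. This time is not negative, and the l-th inequality is then
  -- an equality. The point reached is on a middle edge, but its coordinate sum is still at least b.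
  obtain ⟨l, hl, hmax⟩ := (middle m).exists_max_image
    (fun i => (P.a i - pairing w (P.v i)) / ((P.v i).1 + (P.v i).2 : ℝ)) ⟨j, hj⟩
  set t := (P.a l - pairing w (P.v l)) / ((P.v l).1 + (P.v l).2 : ℝ) with ht
  have ht0 : 0 ≤ t :=
    (div_nonneg (by linarith) (add_pos_of_mem_middle hj).le).trans (hmax j hj)
  have shift : ∀ i, pairing (w.1 + t, w.2 + t) (P.v i)
      = pairing w (P.v i) + t * ((P.v i).1 + (P.v i).2 : ℝ) := fun i => by
    simp only [pairing]; ring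
  have hmem : (w.1 + t, w.2 + t) ∈ P.middleEdges := by
    refine ⟨fun i => ?_, l, hl, ?_⟩
    · by_cases hi0 : i = 0
      · subst hi0
        simp only [P.v_first, P.a_first, pairing]
        push_cast
        linarith
      by_cases hi1 : i = Fin.last (m + 1)
      · subst hi1
        simp only [P.v_last, P.a_last, pairing]
        push_cast
        linarith
      have hi := mem_middle.2 ⟨hi0, hi1⟩
      rw [shift]
      have := (div_le_iff₀ (add_pos_of_mem_middle hi)).1 (hmax i hi)
      linarith
    · rw [shift, ht, div_mul_cancel₀ _ (add_pos_of_mem_middle hl).ne']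
      ring
  have := hE _ hmem
  simp only at this
  linarith

lemma twistProfile_circlePath {β : ℝ} (hb : b < β)
    (hE : ∀ w ∈ P.middleEdges, w.1 + w.2 < b) : P.TwistProfile b (circlePath b β) where
  smooth := contDiff_circlePath b β
  norm_eq _ := Complex.norm_exp_ofReal_mul_I _
  eq_neg_one _ hs := circlePath_of_lt hb hs
  interior _ h1 h2 h3 _ hj := lt_pairing_of_bound hE h1 h2 h3 hj

/-! ### Transport to corner manifolds -/

section Transport

variable {N : Type*} [TopologicalSpace N] [ChartedSpace (ℂ × ℂ) N] [MulAction (Circle × Circle) N]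
  {N' : Type*} [TopologicalSpace N'] [ChartedSpace (ℂ × ℂ) N'] [MulAction (Circle × Circle) N']
  {Ω : BilinField N} {Φ : N → ℝ × ℝ} {Ω' : BilinField N'} {Φ' : N' → ℝ × ℝ}

lemma Identification.liouville_eq (ι : P.Identification Ω Φ) (p : N)
    (u₁ u₂ u₃ u₄ : TangentSpace 𝓘(ℝ, ℂ × ℂ) p) :
    P.modelForm.liouville (ι.toDiffeo p)
      (mfderiv 𝓘(ℝ, ℂ × ℂ) 𝓘(ℝ, ℂ × ℂ) ι.toDiffeo p u₁)
      (mfderiv 𝓘(ℝ, ℂ × ℂ) 𝓘(ℝ, ℂ × ℂ) ι.toDiffeo p u₂)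
      (mfderiv 𝓘(ℝ, ℂ × ℂ) 𝓘(ℝ, ℂ × ℂ) ι.toDiffeo p u₃)
      (mfderiv 𝓘(ℝ, ℂ × ℂ) 𝓘(ℝ, ℂ × ℂ) ι.toDiffeo p u₄)
      = Ω.liouville p u₁ u₂ u₃ u₄ := by
  simp only [BilinField.liouville, ι.symplectic]

/-- The diffeomorphism of corner manifolds that corresponds to the one of the reduced spaces. -/
def mirrorDiffeo (hPQ : P.IsMirror Q) (hc : P.TwistProfile b c) (ι : P.Identification Ω Φ)
    (ι' : Q.Identification Ω' Φ') : N ≃ₘ⟮𝓘(ℝ, ℂ × ℂ), 𝓘(ℝ, ℂ × ℂ)⟯ N' :=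
  (ι.toDiffeo.trans (twistDiffeo hPQ hc)).trans ι'.toDiffeo.symm

variable (hPQ : P.IsMirror Q) (hc : P.TwistProfile b c) (ι : P.Identification Ω Φ)
  (ι' : Q.Identification Ω' Φ')

lemma toDiffeo_mirrorDiffeo (p : N) :
    ι'.toDiffeo (mirrorDiffeo hPQ hc ι ι' p) = twistMap hPQ hc (ι.toDiffeo p) :=
  ι'.toDiffeo.apply_symm_apply _

lemma moment_mirrorDiffeo (p : N) :
    Φ' (mirrorDiffeo hPQ hc ι ι' p) = Q.modelMoment (twistMap hPQ hc (ι.toDiffeo p)) := by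
  rw [← ι'.moment, toDiffeo_mirrorDiffeo]

/-- The identifications and the map of reduced spaces preserve the Liouville volume exactly, hence
so does their composite. -/
lemma preservesOrientation_mirrorDiffeo :
    PreservesOrientation Ω Ω' (mirrorDiffeo hPQ hc ι ι') := by
  intro p u₁ u₂ u₃ u₄ h
  set H := mirrorDiffeo hPQ hc ι ι'
  have e : ι'.toDiffeo ∘ H = twistMap hPQ hc ∘ ι.toDiffeo :=
    funext (toDiffeo_mirrorDiffeo hPQ hc ι ι')
  have d1 := mfderiv_comp (I := 𝓘(ℝ, ℂ × ℂ)) (I' := 𝓘(ℝ, ℂ × ℂ)) (I'' := 𝓘(ℝ, ℂ × ℂ)) p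
    ((ι'.toDiffeo.contMDiff (H p)).mdifferentiableAt (by simp))
    ((H.contMDiff p).mdifferentiableAt (by simp))
  have d2 := mfderiv_comp (I := 𝓘(ℝ, ℂ × ℂ)) (I' := 𝓘(ℝ, ℂ × ℂ)) (I'' := 𝓘(ℝ, ℂ × ℂ)) p
    ((contMDiff_twistMap hPQ hc (ι.toDiffeo p)).mdifferentiableAt (by simp))
    ((ι.toDiffeo.contMDiff p).mdifferentiableAt (by simp))
  rw [e, d2] at d1
  have d : ∀ u : TangentSpace 𝓘(ℝ, ℂ × ℂ) p,
      (mfderiv 𝓘(ℝ, ℂ × ℂ) 𝓘(ℝ, ℂ × ℂ) ι'.toDiffeo (H p)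
        (mfderiv 𝓘(ℝ, ℂ × ℂ) 𝓘(ℝ, ℂ × ℂ) H p u) : ℂ × ℂ) =
      mfderiv 𝓘(ℝ, ℂ × ℂ) 𝓘(ℝ, ℂ × ℂ) (twistMap hPQ hc) (ι.toDiffeo p)
        (mfderiv 𝓘(ℝ, ℂ × ℂ) 𝓘(ℝ, ℂ × ℂ) ι.toDiffeo p u) :=
    fun u => (congrArg (fun L : (ℂ × ℂ) →L[ℝ] (ℂ × ℂ) => L u) d1).symm
  rw [← ι'.liouville_eq]
  rw [← ι.liouville_eq, ← liouville_mfderiv_twistMap hPQ hc] at h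
  -- In preferred charts the reduced form is the same constant form at every point, so the two
  -- expressions for the image point need not be matched.
  simp only [BilinField.liouville, modelForm_apply] at h ⊢
  rw [d, d, d, d]
  exact h

lemma blowup_mirrorDiffeo {p : N} (hb : b ≤ (Φ p).1 + (Φ p).2)
    (h1 : c ((Φ p).1 + (Φ p).2) = 1) :
    ι'.blowup (mirrorDiffeo hPQ hc ι ι' p) = ι.blowup p := by
  rw [← ι.moment] at hb h1
  rw [Identification.blowup, toDiffeo_mirrorDiffeo]
  exact modelBlowup_twistMap hPQ hc _ hb h1

lemma mirrorDiffeo_notMem_chain {p : N} (hb : b ≤ (Φ p).1 + (Φ p).2) :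
    mirrorDiffeo hPQ hc ι ι' p ∉ Q.chain Φ' := by
  rw [← ι.moment] at hb
  simp only [chain, Set.mem_iUnion, not_exists]
  intro i hi h
  rw [sphere, Set.mem_ofPred_eq, moment_mirrorDiffeo hPQ hc ι ι'] at h
  exact twistMap_notMem hPQ hc _ hb (mem_middle.2 hi) h

lemma mirrorDiffeo_smul (l : Circle) (p : N) :
    mirrorDiffeo hPQ hc ι ι' (((l, l⁻¹) : Circle × Circle) • p)
      = ((l, l⁻¹) : Circle × Circle) • mirrorDiffeo hPQ hc ι ι' p := by
  apply ι'.toDiffeo.injective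
  simp only [Diffeomorph.coe_toEquiv]
  rw [ι'.equivariant, toDiffeo_mirrorDiffeo, toDiffeo_mirrorDiffeo, ι.equivariant, twistMap_smul]

lemma mirrorDiffeo_image_sphere {i : Fin (m + 2)} (hi : i ∈ middle m) :
    mirrorDiffeo hPQ hc ι ι' '' P.sphere Φ i = Q.sphere Φ' i.rev := by
  have key : ∀ p, mirrorDiffeo hPQ hc ι ι' p ∈ Q.sphere Φ' i.rev ↔ p ∈ P.sphere Φ i := fun p => by
    rw [sphere, sphere, Set.mem_ofPred_eq, Set.mem_ofPred_eq, moment_mirrorDiffeo hPQ hc ι ι',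
      ← ι.moment]
    exact pairing_twistMap_iff hPQ hc _ hi
  ext q
  obtain ⟨p, rfl⟩ := (mirrorDiffeo hPQ hc ι ι').surjective q
  exact (mirrorDiffeo hPQ hc ι ι').injective.mem_set_image.trans (key p).symm

end Transport

end CornerPolyhedron

end

open CornerPolyhedron in
theorem mainTheorem8 {m : ℕ} (P : CornerPolyhedron m)
    {N : Type*} [TopologicalSpace N] [ChartedSpace (ℂ × ℂ) N] [MulAction (Circle × Circle) N]
    {N' : Type*} [TopologicalSpace N'] [ChartedSpace (ℂ × ℂ) N'] [MulAction (Circle × Circle) N']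
    (Ω : BilinField N) (Φ : N → ℝ × ℝ) (Ω' : BilinField N') (Φ' : N' → ℝ × ℝ)
    (hN : IsCornerManifold Ω Φ) (hΔ : Set.range Φ = P.toSet)
    (hN' : IsCornerManifold Ω' Φ') (hΔ' : Set.range Φ' = P.mirror.toSet)
    (ι : P.Identification Ω Φ) (ι' : P.mirror.Identification Ω' Φ')
    (β : ℝ) (hβ : 0 < β) (hU : P.chain Φ ⊆ triangular Φ β) :
    ∃ H : N ≃ₘ⟮𝓘(ℝ, ℂ × ℂ), 𝓘(ℝ, ℂ × ℂ)⟯ N',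
      PreservesOrientation Ω Ω' H ∧
      (∀ p, p ∉ triangular Φ β →
        H p ∉ P.mirror.chain Φ' ∧ ι'.blowup (H p) = ι.blowup p) ∧
      (∀ p, (Φ' (H p)).1 + (Φ' (H p)).2 = (Φ p).1 + (Φ p).2) ∧
      (∀ (l : Circle) (p : N),
        H (((l, l⁻¹) : Circle × Circle) • p) = ((l, l⁻¹) : Circle × Circle) • H p) ∧
      (∀ i : Fin (m + 2), i ≠ 0 → i ≠ Fin.last (m + 1) →
        H '' P.sphere Φ i = P.mirror.sphere Φ' i.rev) := by
  -- A point of a middle edge lies in Δ, the image of Φ, hence is the moment of a point of the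
  -- chain.
  have hE : ∀ w ∈ P.middleEdges, w.1 + w.2 < β := by
    rintro w ⟨hw, j, hj, hwj⟩
    rw [← hΔ] at hw
    obtain ⟨p, rfl⟩ := hw
    exact (hU (Set.mem_biUnion (x := j) (mem_middle.1 hj) hwj)).2.2
  obtain ⟨b, hb, hEb⟩ := exists_bound_of_middleEdges hE
  have hc := twistProfile_circlePath hb hEb
  have hPQ := P.isMirror_mirror
  refine ⟨mirrorDiffeo hPQ hc ι ι', preservesOrientation_mirrorDiffeo hPQ hc ι ι', fun p hp => ?_,
    fun p => ?_, mirrorDiffeo_smul hPQ hc ι ι',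
    fun i h0 h1 => mirrorDiffeo_image_sphere hPQ hc ι ι' (mem_middle.2 ⟨h0, h1⟩)⟩
  · have hp' : β ≤ (Φ p).1 + (Φ p).2 := by
      by_contra! h
      exact hp ⟨(hN.image_subset p).1, (hN.image_subset p).2, h⟩
    exact ⟨mirrorDiffeo_notMem_chain hPQ hc ι ι' (hb.le.trans hp'),
      blowup_mirrorDiffeo hPQ hc ι ι' (hb.le.trans hp') (circlePath_of_le hb hp')⟩
  · rw [moment_mirrorDiffeo hPQ hc ι ι', modelMoment_twistMap_add, ι.moment]
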